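/- Let $X(t)$, $t\in\mathbb R$, be a measurable, mean-square continuous, real-valued, stationary, zero-mean Gaussian process on a probability space $(\Omega,\mathcal F,P)$ with spectral density $f$, i.e. $\operatorname{Cov}(X(t),X(t'))=\int_{\mathbb R}e^{iu(t-t')}f(u)\,du$, of the form $$f(\lambda)=\frac{h(\lambda)}{|\lambda^2-s_0^2|^{2\alpha}},\qquad s_0>1,\ \alpha\in(0,1/2),$$ where $h$ is even, non-negative, bounded and four times continuously differentiable, $h(0)=1$, $h^{(i)}(0)=0$ for $i=1,2,3,4$, $h>0$ in some neighbourhood of $\pm s_0$, and $\int_{\mathbb R}h(\lambda)(1+|\lambda|)^{-\varepsilon}d\lambda<\infty$ for every $\varepsilon>0$. Let $\psi\in L_1(\mathbb R)$ be real-valued with Fourier transform $\widehat\psi(\lambda)=\int_{\mathbb R}e^{-i\lambda t}\psi(t)\,dt$, and let $0<B<A$ be such that $\widehat\psi$ is of bounded variation on $[-A,A]$ and $\operatorname{supp}\widehat\psi\subseteq\{\xi\in\mathbb R: B\le|\xi|\le A\}$. Let $(a_j)_{j\in\mathbb N}$ be a strictly increasing unbounded sequence of positive reals, $(m_j)_{j\in\mathbb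 N}$ a non-decreasing unbounded sequence of positive integers, $(\gamma_j)_{j\in\mathbb N}$ a sequence of positive reals and $(b_{jk})_{(j,k)\in\mathbb N\times\mathbb Z}$ an array of reals such that $b_{jk}-b_{jl}=\gamma_j(k-l)$ for all $j\in\mathbb N$, $k,l\in\mathbb Z$. Assume that for some $c\in(0,\infty)$ $$\lim_{j\to\infty}\frac{a_j}{\gamma_j}=c,\qquad \lim_{j\to\infty}m_j^2a_j^8\Big(\frac{\gamma_j}{a_j}-\frac1c\Big)=0,$$ that $a_{j+1}/a_j\ge A/B$ for all $j\ge j_0$, for some $j_0\in\mathbb N$, and that $\lim_{j\to\infty}m_ja_j^{-4}=0$. Put $$\delta_{jk}=\frac1{\sqrt{a_j}}\int_{\mathbb R}\psi\Big(\frac{t-b_{jk}}{a_j}\Big)X(t)\,dt,\qquad \overline\delta_j^{(2,n)}=\frac1n\sum_{k=1}^{n}\delta_{jk}^2,\qquad M_j=\Big[\frac{m_j}{(a_{j+1}^{-2}-a_{j+2}^{-2})^2}\Big],$$ where $[\cdot]$ is the integer part, and $$\Delta\overline\delta_{j+1}^{(2,M_j)}=\frac{\overline\delta_{j+1}^{(2,M_j)}-\overline\delta_{j+2}^{(2,M_j)}}{a_{j+1}^{-2}-a_{j+2}^{-2}}.$$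 Then, as $j\to\infty$, the random variables $$\sqrt{m_j}\Big(\Delta\overline\delta_{j+1}^{(2,M_j)}-2\alpha s_0^{-4\alpha-2}\int_{\mathbb R}\eta^2|\widehat\psi(\eta)|^2\,d\eta\Big)$$ converge in distribution to a centred Gaussian random variable with variance $2\mathcal V_1$, where $$\mathcal V_1=4c\pi s_0^{-8\alpha}\int_{-c\pi}^{c\pi}\Big|\sum_{n\in\mathbb Z}|\widehat\psi(\eta+2nc\pi)|^2\Big|^2d\eta$$ (if $\psi=0$ almost everywhere, then $\mathcal V_1=0$ and the limit law is the point mass at $0$). -/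

import Mathlib

open MeasureTheory ProbabilityTheory Filter Topology Set

/-- The Fourier transform `ψ̂(x) = ∫ e^{-ixt} ψ(t) dt` of a real-valued function. -/
noncomputable def fourierHat (ψ : ℝ → ℝ) (x : ℝ) : ℂ :=
  ∫ t : ℝ, Complex.exp (-(Complex.I * x * t)) * ψ t

/-- `X` is a measurable, mean-square continuous, (strictly) stationary, centred, real-valued
Gaussian process on the probability space `(Ω, P)`. -/
structure IsStationaryGaussian {Ω : Type*} [MeasurableSpace Ω] (P : Measure Ω)
    (X : ℝ → Ω → ℝ) : Prop where
  measurable_uncurry : Measurable (fun p : ℝ × Ω => X p.1 p.2)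
  gaussian : IsGaussianProcess X P
  centred : ∀ t : ℝ, ∫ ω, X t ω ∂P = 0
  meanSquare_continuous :
    ∀ t : ℝ, Tendsto (fun s : ℝ => ∫ ω, (X s ω - X t ω) ^ 2 ∂P) (𝓝 t) (𝓝 0)
  stationary :
    ∀ r : ℝ, P.map (fun ω (t : ℝ) => X (t + r) ω) = P.map (fun ω (t : ℝ) => X t ω)

/-- `f` is the spectral density of `X`: it is non-negative, in `L₁(ℝ)`, and
`Cov(X(t), X(t')) = ∫ e^{iu(t-t')} f(u) du`. -/
structure HasSpectralDensity {Ω : Type*} [MeasurableSpace Ω] (P : Measure Ω)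
    (X : ℝ → Ω → ℝ) (f : ℝ → ℝ) : Prop where
  nonneg : ∀ u : ℝ, 0 ≤ f u
  integrable : Integrable f
  covariance_eq : ∀ t t' : ℝ,
    ((covariance (X t) (X t') P : ℝ) : ℂ) =
      ∫ u : ℝ, Complex.exp (Complex.I * u * ((t - t' : ℝ) : ℂ)) * (f u : ℂ)

/-- The semiparametric spectral density `h(x) / |x² - s₀²|^{2α}`. -/
noncomputable def cyclicDensity (s₀ α : ℝ) (h : ℝ → ℝ) (x : ℝ) : ℝ :=
  h x / |x ^ 2 - s₀ ^ 2| ^ (2 * α)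

/-- The conditions on the parameters `s₀`, `α` and on the function `h` of the semiparametric
model. -/
structure IsCyclicModel (s₀ α : ℝ) (h : ℝ → ℝ) : Prop where
  one_lt : 1 < s₀
  alpha_pos : 0 < α
  alpha_lt : α < 1 / 2
  even : ∀ x : ℝ, h (-x) = h x
  nonneg : ∀ x : ℝ, 0 ≤ h x
  bounded : ∃ C : ℝ, ∀ x : ℝ, h x ≤ C
  contDiff : ContDiff ℝ 4 h
  iteratedDeriv_zero : ∀ i ∈ Finset.Icc 1 4, iteratedDeriv i h 0 = 0
  at_zero : h 0 = 1
  pos_near : ∀ᶠ x in 𝓝 s₀, 0 < h x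
  pos_near_neg : ∀ᶠ x in 𝓝 (-s₀), 0 < h x
  integrable : ∀ ε : ℝ, 0 < ε → Integrable (fun x : ℝ => h x / (1 + |x|) ^ ε)

/-- The filter transform `δ_{jk} = a_j^{-1/2} ∫ ψ((t - b_{jk}) / a_j) X(t) dt`, a random variable. -/
noncomputable def filterTransform {Ω : Type*} (ψ : ℝ → ℝ) (X : ℝ → Ω → ℝ) (a : ℕ → ℝ)
    (b : ℕ → ℤ → ℝ) (j : ℕ) (k : ℤ) (ω : Ω) : ℝ :=
  (1 / √(a j)) * ∫ t : ℝ, ψ ((t - b j k) / a j) * X t ω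

/-- The mean squared filter coefficient `(1/n) ∑_{k=1}^n δ_{jk}²` of level `j`. -/
noncomputable def meanSquareCoeff {Ω : Type*} (ψ : ℝ → ℝ) (X : ℝ → Ω → ℝ) (a : ℕ → ℝ)
    (b : ℕ → ℤ → ℝ) (j n : ℕ) (ω : Ω) : ℝ :=
  (1 / (n : ℝ)) * ∑ k ∈ Finset.Icc 1 n, filterTransform ψ X a b j (k : ℤ) ω ^ 2

/-- `M_j = [m_j / (a_{j+1}^{-2} - a_{j+2}^{-2})²]`, integer part. -/
noncomputable def sampleSize (a : ℕ → ℝ) (m : ℕ → ℕ) (j : ℕ) : ℕ :=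
  ⌊(m j : ℝ) / ((a (j + 1) ^ 2)⁻¹ - (a (j + 2) ^ 2)⁻¹) ^ 2⌋₊

/-- The normalised increment, between the levels `j + 1` and `j + 2`, of the mean squared
coefficients computed from `M_j` coefficients at each of the two levels. -/
noncomputable def normalisedIncrement {Ω : Type*} (ψ : ℝ → ℝ) (X : ℝ → Ω → ℝ) (a : ℕ → ℝ)
    (b : ℕ → ℤ → ℝ) (m : ℕ → ℕ) (j : ℕ) (ω : Ω) : ℝ :=
  (meanSquareCoeff ψ X a b (j + 1) (sampleSize a m j) ω -
      meanSquareCoeff ψ X a b (j + 2) (sampleSize a m j) ω) /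
    ((a (j + 1) ^ 2)⁻¹ - (a (j + 2) ^ 2)⁻¹)

/-- `𝒱₁ = 4cπ s₀^{-8α} ∫_{-cπ}^{cπ} |∑_{n ∈ ℤ} |ψ̂(η + 2ncπ)|²|² dη`. -/
noncomputable def limitVariance (ψ : ℝ → ℝ) (s₀ α c : ℝ) : ℝ :=
  4 * c * Real.pi * s₀ ^ (-8 * α) *
    ∫ η in (-(c * Real.pi))..(c * Real.pi),
      |∑' n : ℤ, ‖fourierHat ψ (η + 2 * n * c * Real.pi)‖ ^ 2| ^ 2

/-!
The two coefficient arrays entering the increment, at the levels `j + 1` and `j + 2`, are linear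
functionals of the Gaussian process `X`. They lie in the closed linear span of `X` in `L²(P)`
(`processIntegral_mem_processSpace`), and all finite families in that span are jointly Gaussian
(`hasGaussianLaw_of_mem_processSpace`). The whole array is therefore described by its covariances,
which the spectral representation computes.

* Within a level, the covariance of the coefficients `k` and `l` is a Fourier coefficient of index
  `k - l`, so the covariance matrix is a Toeplitz matrix whose symbol is the dilated function
  `θ ↦ f (T θ / a) ‖ψ̂ (T θ)‖ ^ 2` up to a factor (`integral_filter_mul_filter_same`).
* Across the two levels the spectral supports meet in a null set, because `a (j + 2) / a (j + 1)`
  is at least `A / B`; hence the levels are uncorrelated (`integral_filter_mul_filter_diff`), and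
  so independent.

A rotation inside each level turns the coefficients into independent centred Gaussian variables
(`exists_independent_rotation`) without changing the sum of the squares. The variances of the
rotated variables are bounded by the supremum of the periodised symbol (`toeplitz_form_le`), and
the sum of their squares is the sum of the squared entries of the covariance matrix. The expansion
of the characteristic function of a centred square then yields the central limit theorem
`tendsto_charFun_sum_weight_mul_sum_sq`.

The limiting variance comes from Parseval's identity: averaged over the sample, the sum of the
squared entries of the Toeplitz matrix tends to the squared `L²` norm of the periodised symbol
(`tendsto_toeplitz_average_sq_cosCoeff`), and `limitVariance_eq` identifies that norm.

The centring comes from the behaviour of the density near the origin. As `h` is `1` up to order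
four there, `f x = s₀ ^ (-4α) + 2 α s₀ ^ (-4α - 2) x ^ 2 + O(x ^ 4)`
(`exists_abs_cyclicDensity_sub_le`), so the divided difference of the mean squares differs from
`2 α s₀ ^ (-4α - 2) ∫ η ^ 2 ‖ψ̂ η‖ ^ 2` by `O(a ^ (-2))`, which is negligible against `√m` since
`m / a ^ 4` tends to zero (`tendsto_sqrt_mul_divided_difference`).
-/

/-! ### The Gaussian Hilbert space of a process -/

section GaussianSpace

variable {Ω T : Type*} [MeasurableSpace Ω] {P : Measure Ω}

/-- The closed linear span in `L²(P)` of a square-integrable process. -/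
noncomputable def processSpace {X : T → Ω → ℝ} (hX : ∀ t, MemLp (X t) 2 P) :
    Submodule ℝ (Lp ℝ 2 P) :=
  (Submodule.span ℝ (range fun t => (hX t).toLp)).topologicalClosure

lemma norm_exp_mul_I_sub_exp_mul_I_le (x y : ℝ) :
    ‖Complex.exp (x * Complex.I) - Complex.exp (y * Complex.I)‖ ≤ |x - y| := by
  have h : Complex.exp (x * Complex.I) - Complex.exp (y * Complex.I) =
      Complex.exp (y * Complex.I) * (Complex.exp (Complex.I * ((x - y : ℝ) : ℂ)) - 1) := by
    rw [mul_sub, ← Complex.exp_add, mul_one]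
    congr 2
    push_cast; ring
  rw [h, norm_mul, Complex.norm_exp_ofReal_mul_I, one_mul]
  simpa using Real.norm_exp_I_mul_ofReal_sub_one_le (x := x - y)

lemma integral_abs_le_norm_Lp_two [IsProbabilityMeasure P] (Y : Lp ℝ 2 P) :
    ∫ ω, |Y ω| ∂P ≤ ‖Y‖ := by
  have h1 : ∫ ω, |Y ω| ∂P = (eLpNorm Y 1 P).toReal := by
    rw [eLpNorm_one_eq_lintegral_enorm, ← integral_norm_eq_lintegral_enorm
      (Lp.aestronglyMeasurable Y)]
    rfl
  rw [h1, Lp.norm_def]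
  exact ENNReal.toReal_mono (Lp.eLpNorm_ne_top Y)
    (eLpNorm_le_eLpNorm_of_exponent_le (by norm_num) (Lp.aestronglyMeasurable Y))

lemma integrable_exp_mul_I [IsProbabilityMeasure P] {Y : Ω → ℝ} (hY : AEStronglyMeasurable Y P) :
    Integrable (fun ω => Complex.exp (Y ω * Complex.I)) P := by
  refine Integrable.of_bound (C := 1) ?_ (ae_of_all _ fun ω => ?_)
  · exact (by fun_prop : Continuous fun x : ℝ =>
      Complex.exp (x * Complex.I)).comp_aestronglyMeasurable hY
  · rw [Complex.norm_exp_ofReal_mul_I]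

lemma continuous_integral_exp_mul_I [IsProbabilityMeasure P] :
    Continuous fun Y : Lp ℝ 2 P => ∫ ω, Complex.exp (Y ω * Complex.I) ∂P := by
  refine LipschitzWith.continuous (K := 1) (LipschitzWith.of_dist_le_mul fun U V => ?_)
  rw [NNReal.coe_one, one_mul, dist_eq_norm, dist_eq_norm,
    ← integral_sub (integrable_exp_mul_I (Lp.aestronglyMeasurable U))
      (integrable_exp_mul_I (Lp.aestronglyMeasurable V))]
  refine (norm_integral_le_integral_norm _).trans
    (le_trans ?_ (integral_abs_le_norm_Lp_two (U - V)))
  refine integral_mono_of_nonneg (ae_of_all _ fun _ => norm_nonneg _)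
    ((Lp.memLp (U - V)).integrable (by norm_num)).abs ?_
  filter_upwards [Lp.coeFn_sub U V] with ω hω
  simp only [hω, Pi.sub_apply]
  exact norm_exp_mul_I_sub_exp_mul_I_le _ _

lemma norm_sq_Lp_two (Y : Lp ℝ 2 P) : ‖Y‖ ^ 2 = ∫ ω, Y ω ^ 2 ∂P := by
  rw [← real_inner_self_eq_norm_sq, L2.inner_def]
  exact integral_congr_ae (ae_of_all _ fun ω => by simp [sq])

lemma integral_exp_mul_I_of_hasGaussianLaw {Y : Ω → ℝ} (hY : HasGaussianLaw Y P)
    (h0 : ∫ ω, Y ω ∂P = 0) :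
    ∫ ω, Complex.exp (Y ω * Complex.I) ∂P = Complex.exp (-((∫ ω, Y ω ^ 2 ∂P : ℝ) : ℂ) / 2) := by
  have h := hY.map_eq_gaussianReal
  have h1 : charFun (P.map Y) 1 = ∫ ω, Complex.exp (Y ω * Complex.I) ∂P := by
    rw [charFun_apply_real, integral_map hY.aemeasurable (by fun_prop)]
    simp
  rw [← h1, h, charFun_gaussianReal, h0, variance_of_integral_eq_zero hY.aemeasurable h0]
  rw [Real.coe_toNNReal _ (integral_nonneg fun _ => sq_nonneg _)]
  congr 1
  simp only [Complex.ofReal_one, Complex.ofReal_zero]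
  ring

/-- Elements of the closed span of a centred Gaussian process are centred Gaussian: the identity
`E e^{iY} = e^{-‖Y‖²/2}` holds on the span and is preserved by `L²` limits. -/
lemma integral_exp_mul_I_of_mem_processSpace [IsProbabilityMeasure P] {X : T → Ω → ℝ}
    (hX : ∀ t, MemLp (X t) 2 P) (hG : IsGaussianProcess X P) (h0 : ∀ t, ∫ ω, X t ω ∂P = 0)
    {Y : Lp ℝ 2 P}
    (hY : Y ∈ processSpace hX) :
    ∫ ω, Complex.exp (Y ω * Complex.I) ∂P = Complex.exp (-((‖Y‖ ^ 2 : ℝ) : ℂ) / 2) := by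
  have hcl : IsClosed {Y : Lp ℝ 2 P | ∫ ω, Complex.exp (Y ω * Complex.I) ∂P =
      Complex.exp (-((‖Y‖ ^ 2 : ℝ) : ℂ) / 2)} :=
    isClosed_eq continuous_integral_exp_mul_I (by fun_prop)
  refine closure_minimal (fun Z hZ => ?_) hcl hY
  obtain ⟨c, rfl⟩ := Finsupp.mem_span_range_iff_exists_finsupp.1 hZ
  have hae : (c.sum fun i a => a • (hX i).toLp : Lp ℝ 2 P) =ᵐ[P]
      fun ω => ∑ i ∈ c.support, c i * X i ω := by
    rw [Finsupp.sum]
    refine (Lp.coeFn_finsetSum _ _).trans ?_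
    have : ∀ᵐ ω ∂P, ∀ i ∈ c.support, (c i • (hX i).toLp : Lp ℝ 2 P) ω = c i * X i ω := by
      refine (ae_ball_iff (Finset.countable_toSet _)).2 fun i _ => ?_
      filter_upwards [Lp.coeFn_smul (c i) (hX i).toLp, (hX i).coeFn_toLp] with ω h1 h2
      rw [h1, Pi.smul_apply, h2, smul_eq_mul]
    filter_upwards [this] with ω hω
    simp only [Finset.sum_apply]
    exact Finset.sum_congr rfl hω
  have hlaw : HasGaussianLaw (fun ω => ∑ i ∈ c.support, c i * X i ω) P := by
    have := (hG.smul (fun i => c i)).hasGaussianLaw_fun_sum (I := c.support)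
    simpa using this
  have hmean : ∫ ω, ∑ i ∈ c.support, c i * X i ω ∂P = 0 := by
    rw [integral_finsetSum _ fun i _ => ((hX i).integrable (by norm_num)).const_mul _]
    exact Finset.sum_eq_zero fun i _ => by rw [integral_const_mul, h0, mul_zero]
  have := integral_exp_mul_I_of_hasGaussianLaw hlaw hmean
  simp only [mem_ofPred_eq]
  rw [norm_sq_Lp_two]
  convert this using 1
  · exact integral_congr_ae (hae.mono fun ω hω => by simp only [hω])
  · congr 4
    exact integral_congr_ae (hae.mono fun ω hω => by simp only [hω])

lemma map_eq_gaussianReal_of_mem_processSpace [IsProbabilityMeasure P] {X : T → Ω → ℝ}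
    (hX : ∀ t, MemLp (X t) 2 P) (hG : IsGaussianProcess X P) (h0 : ∀ t, ∫ ω, X t ω ∂P = 0)
    {Y : Lp ℝ 2 P}
    (hY : Y ∈ processSpace hX) :
    P.map Y = gaussianReal 0 (‖Y‖ ^ 2).toNNReal := by
  have hm : AEMeasurable Y P := (Lp.aestronglyMeasurable Y).aemeasurable
  have : IsProbabilityMeasure (P.map Y) := Measure.isProbabilityMeasure_map hm
  refine Measure.ext_of_charFun (funext fun t => ?_)
  have h := integral_exp_mul_I_of_mem_processSpace hX hG h0
    ((processSpace hX).smul_mem t hY)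
  rw [charFun_gaussianReal, charFun_apply_real, integral_map hm (by fun_prop),
    Real.coe_toNNReal _ (sq_nonneg _)]
  refine Eq.trans (integral_congr_ae ?_) (h.trans ?_)
  · filter_upwards [Lp.coeFn_smul t Y] with ω hω
    simp [hω]
  · congr 1
    rw [norm_smul, mul_pow, Real.norm_eq_abs, sq_abs]
    push_cast
    ring

lemma toLp_finset_sum_mul {ι : Type*} [Fintype ι] {Y : ι → Ω → ℝ} (hY : ∀ i, MemLp (Y i) 2 P)
    (c : ι → ℝ) (h : MemLp (fun ω => ∑ i, c i * Y i ω) 2 P) :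
    h.toLp = ∑ i, c i • (hY i).toLp := by
  refine Lp.ext (h.coeFn_toLp.trans ?_)
  refine EventuallyEq.trans ?_ (Lp.coeFn_finsetSum _ _).symm
  have : ∀ᵐ ω ∂P, ∀ i, (c i • (hY i).toLp : Lp ℝ 2 P) ω = c i * Y i ω := by
    refine ae_all_iff.2 fun i => ?_
    filter_upwards [Lp.coeFn_smul (c i) (hY i).toLp, (hY i).coeFn_toLp] with ω h1 h2
    rw [h1, Pi.smul_apply, h2, smul_eq_mul]
  filter_upwards [this] with ω hω
  simp [hω]

lemma memLp_finset_sum_mul {ι : Type*} [Fintype ι] {Y : ι → Ω → ℝ} (hY : ∀ i, MemLp (Y i) 2 P)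
    (c : ι → ℝ) : MemLp (fun ω => ∑ i, c i * Y i ω) 2 P :=
  memLp_finsetSum _ fun i _ => (hY i).const_mul _

/-- Finitely many elements of the closed span of a centred Gaussian process are jointly
Gaussian. -/
theorem hasGaussianLaw_of_mem_processSpace [IsProbabilityMeasure P] {X : T → Ω → ℝ}
    (hX : ∀ t, MemLp (X t) 2 P) (hG : IsGaussianProcess X P) (h0 : ∀ t, ∫ ω, X t ω ∂P = 0)
    {ι : Type*} [Fintype ι] {Y : ι → Ω → ℝ} (hY : ∀ i, MemLp (Y i) 2 P) (hmem : ∀ i, (hY i).toLp ∈ processSpace hX) :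
    HasGaussianLaw (fun ω i => Y i ω) P := by
  classical
  have hmeas : AEMeasurable (fun ω i => Y i ω) P :=
    aemeasurable_pi_lambda _ fun i => (hY i).aestronglyMeasurable.aemeasurable
  refine ⟨isGaussian_of_map_eq_gaussianReal fun L => ?_⟩
  rw [AEMeasurable.map_map_of_aemeasurable (by fun_prop) hmeas]
  have hL : (L ∘ fun ω i => Y i ω) = fun ω => ∑ i, L (Pi.single i 1) * Y i ω := by
    funext ω
    simp only [Function.comp_apply]
    conv_lhs => rw [pi_eq_sum_univ' (fun i => Y i ω)]
    simp [map_sum, mul_comm]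
  have hs := memLp_finset_sum_mul hY fun i => L (Pi.single i 1)
  rw [hL, ← Measure.map_congr hs.coeFn_toLp]
  refine ⟨_, _, map_eq_gaussianReal_of_mem_processSpace hX hG h0 ?_⟩
  rw [toLp_finset_sum_mul hY]
  exact Submodule.sum_mem _ fun i _ => Submodule.smul_mem _ _ (hmem i)

/-- Elements of the closed span of a centred process are centred. -/
lemma integral_eq_zero_of_mem_processSpace [IsProbabilityMeasure P] {X : T → Ω → ℝ}
    (hX : ∀ t, MemLp (X t) 2 P) (hG : IsGaussianProcess X P) (h0 : ∀ t, ∫ ω, X t ω ∂P = 0)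
    {Y : Ω → ℝ} (hY : MemLp Y 2 P)
    (hmem : hY.toLp ∈ processSpace hX) : ∫ ω, Y ω ∂P = 0 := by
  have h := map_eq_gaussianReal_of_mem_processSpace hX hG h0 hmem
  rw [Measure.map_congr hY.coeFn_toLp] at h
  have h1 : ∫ ω, Y ω ∂P = ∫ x, x ∂(P.map Y) :=
    (integral_map (f := fun x => x) hY.aestronglyMeasurable.aemeasurable (by fun_prop)).symm
  rw [h1, h, integral_id_gaussianReal]

end GaussianSpace

/-! ### Pathwise integrals of a measurable process -/

section ProcessIntegral

variable {Ω : Type*} [MeasurableSpace Ω] {P : Measure Ω}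

/-- The pathwise integral `∫ φ(t) X(t) dt` of a process against a weight. -/
noncomputable def processIntegral (X : ℝ → Ω → ℝ) (φ : ℝ → ℝ) (ω : Ω) : ℝ :=
  ∫ t : ℝ, φ t * X t ω

variable {X : ℝ → Ω → ℝ} {φ : ℝ → ℝ} {V : ℝ}

lemma integrable_prod_weight_mul [IsProbabilityMeasure P]
    (hXm : Measurable fun p : ℝ × Ω => X p.1 p.2) (hX : ∀ t, MemLp (X t) 2 P)
    (hV : ∀ t, ∫ ω, X t ω ^ 2 ∂P ≤ V) (hφ : Integrable φ) {Z : Ω → ℝ} (hZ : MemLp Z 2 P) :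
    Integrable (fun p : ℝ × Ω => φ p.1 * (X p.1 p.2 * Z p.2)) (volume.prod P) := by
  have hm : AEStronglyMeasurable (fun p : ℝ × Ω => φ p.1 * (X p.1 p.2 * Z p.2))
      (volume.prod P) :=
    hφ.aestronglyMeasurable.comp_fst.mul
      (hXm.aestronglyMeasurable.mul hZ.aestronglyMeasurable.comp_snd)
  refine (integrable_prod_iff hm).2 ⟨ae_of_all _ fun t => ?_, ?_⟩
  · exact ((hX t).integrable_mul hZ).const_mul (φ t)
  · refine (hφ.abs.mul_const (V + ∫ ω, Z ω ^ 2 ∂P)).mono' hm.norm.integral_prod_right' ?_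
    refine ae_of_all _ fun t => ?_
    have h1 := (hX t).integrable_sq
    have h2 := hZ.integrable_sq
    have h3 : ∫ ω, |X t ω * Z ω| ∂P ≤ V + ∫ ω, Z ω ^ 2 ∂P := by
      calc ∫ ω, |X t ω * Z ω| ∂P ≤ ∫ ω, (X t ω ^ 2 + Z ω ^ 2) ∂P := by
            refine integral_mono ((hX t).integrable_mul hZ).abs (h1.add h2) fun ω => ?_
            simp only [abs_mul]
            nlinarith [sq_nonneg (|X t ω| - |Z ω|), sq_abs (X t ω), sq_abs (Z ω),
              sq_nonneg (X t ω), sq_nonneg (Z ω)]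
        _ = ∫ ω, X t ω ^ 2 ∂P + ∫ ω, Z ω ^ 2 ∂P := integral_add h1 h2
        _ ≤ _ := by linarith [hV t]
    rw [Real.norm_of_nonneg (integral_nonneg fun _ => norm_nonneg _)]
    simp only [norm_mul, Real.norm_eq_abs, integral_const_mul]
    exact mul_le_mul_of_nonneg_left (by simpa only [abs_mul] using h3) (abs_nonneg _)

lemma integrable_prod_weight_sq [IsProbabilityMeasure P]
    (hXm : Measurable fun p : ℝ × Ω => X p.1 p.2) (hX : ∀ t, MemLp (X t) 2 P)
    (hV : ∀ t, ∫ ω, X t ω ^ 2 ∂P ≤ V) (hφ : Integrable φ) :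
    Integrable (fun p : ℝ × Ω => |φ p.1| * X p.1 p.2 ^ 2) (volume.prod P) := by
  have hm : AEStronglyMeasurable (fun p : ℝ × Ω => |φ p.1| * X p.1 p.2 ^ 2) (volume.prod P) :=
    hφ.abs.aestronglyMeasurable.comp_fst.mul (hXm.pow_const 2).aestronglyMeasurable
  refine (integrable_prod_iff hm).2 ⟨ae_of_all _ fun t => ?_, ?_⟩
  · exact (hX t).integrable_sq.const_mul |φ t|
  · refine (hφ.abs.mul_const V).mono' hm.norm.integral_prod_right' (ae_of_all _ fun t => ?_)
    rw [Real.norm_of_nonneg (integral_nonneg fun _ => norm_nonneg _)]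
    simp only [norm_mul, Real.norm_eq_abs, abs_abs, integral_const_mul, norm_pow, sq_abs]
    exact mul_le_mul_of_nonneg_left (hV t) (abs_nonneg _)

lemma ae_integrable_weight_mul [IsProbabilityMeasure P]
    (hXm : Measurable fun p : ℝ × Ω => X p.1 p.2) (hX : ∀ t, MemLp (X t) 2 P)
    (hV : ∀ t, ∫ ω, X t ω ^ 2 ∂P ≤ V) (hφ : Integrable φ) :
    ∀ᵐ ω ∂P, Integrable fun t => φ t * X t ω := by
  have h := integrable_prod_weight_mul hXm hX hV hφ (memLp_const (1 : ℝ))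
  simpa using h.prod_left_ae

/-- The Cauchy–Schwarz inequality for the weight `|φ|`. -/
lemma sq_integral_weight_mul_le {x : ℝ → ℝ} (hφ : Integrable φ)
    (h1 : Integrable fun t => φ t * x t) (h2 : Integrable fun t => |φ t| * x t ^ 2) :
    (∫ t, φ t * x t) ^ 2 ≤ (∫ t, |φ t|) * ∫ t, |φ t| * x t ^ 2 := by
  have h1' : Integrable fun t => |φ t| * |x t| := by simpa only [abs_mul] using h1.abs
  have key : ∀ m : ℝ, 0 ≤ (∫ t, |φ t|) * (m * m) + (-2 * ∫ t, |φ t| * |x t|) * m +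
      ∫ t, |φ t| * x t ^ 2 := by
    intro m
    have : ∫ t, |φ t| * (|x t| - m) ^ 2 = (∫ t, |φ t|) * (m * m) +
        (-2 * ∫ t, |φ t| * |x t|) * m + ∫ t, |φ t| * x t ^ 2 := by
      have i1 : Integrable fun t => |φ t| * (m * m) := hφ.abs.mul_const _
      have i2 : Integrable fun t => -2 * (|φ t| * |x t|) * m := (h1'.const_mul _).mul_const _
      have i3 : Integrable fun t => |φ t| * (m * m) + -2 * (|φ t| * |x t|) * m := i1.add i2
      rw [← integral_mul_const, ← integral_const_mul, ← integral_mul_const, ← integral_add i1 i2,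
        ← integral_add i3 h2]
      refine integral_congr_ae (ae_of_all _ fun t => ?_)
      simp only
      rw [sub_sq, sq_abs]
      ring
    rw [← this]
    exact integral_nonneg fun t => by positivity
  have hd := discrim_le_zero key
  have hle : |∫ t, φ t * x t| ≤ ∫ t, |φ t| * |x t| := by
    simpa only [Real.norm_eq_abs, abs_mul] using norm_integral_le_integral_norm (fun t => φ t * x t)
  have hsq : (∫ t, φ t * x t) ^ 2 ≤ (∫ t, |φ t| * |x t|) ^ 2 := by
    rw [← sq_abs]; gcongr
  unfold discrim at hd
  nlinarith

lemma aestronglyMeasurable_processIntegral (hXm : Measurable fun p : ℝ × Ω => X p.1 p.2)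
    (hφ : Integrable φ) : AEStronglyMeasurable (processIntegral X φ) P := by
  -- modifying `φ` on a null set does not change the pathwise integral at any `ω`
  have hae := hφ.aestronglyMeasurable.ae_eq_mk
  have : processIntegral X φ = processIntegral X (hφ.aestronglyMeasurable.mk φ) := by
    funext ω
    exact integral_congr_ae (hae.mono fun t ht => by simp only [ht])
  rw [this]
  have hsm : StronglyMeasurable fun p : ℝ × Ω =>
      hφ.aestronglyMeasurable.mk φ p.1 * X p.1 p.2 :=
    (hφ.aestronglyMeasurable.stronglyMeasurable_mk.comp_measurable measurable_fst).mul
      hXm.stronglyMeasurable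
  exact hsm.integral_prod_left'.aestronglyMeasurable

lemma memLp_processIntegral [IsProbabilityMeasure P]
    (hXm : Measurable fun p : ℝ × Ω => X p.1 p.2) (hX : ∀ t, MemLp (X t) 2 P)
    (hV : ∀ t, ∫ ω, X t ω ^ 2 ∂P ≤ V) (hφ : Integrable φ) :
    MemLp (processIntegral X φ) 2 P := by
  have hm : AEStronglyMeasurable (processIntegral X φ) P :=
    aestronglyMeasurable_processIntegral hXm hφ
  refine (memLp_two_iff_integrable_sq hm).2 ?_
  have hsq := integrable_prod_weight_sq hXm hX hV hφ
  refine (hsq.integral_prod_right.const_mul (∫ t, |φ t|)).mono' (hm.pow 2) ?_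
  filter_upwards [ae_integrable_weight_mul hXm hX hV hφ, hsq.prod_left_ae] with ω h1 h2
  rw [Real.norm_of_nonneg (sq_nonneg _)]
  exact sq_integral_weight_mul_le hφ h1 h2

lemma integral_processIntegral_mul [IsProbabilityMeasure P]
    (hXm : Measurable fun p : ℝ × Ω => X p.1 p.2) (hX : ∀ t, MemLp (X t) 2 P)
    (hV : ∀ t, ∫ ω, X t ω ^ 2 ∂P ≤ V) (hφ : Integrable φ) {Z : Ω → ℝ} (hZ : MemLp Z 2 P) :
    ∫ ω, processIntegral X φ ω * Z ω ∂P = ∫ t, φ t * ∫ ω, X t ω * Z ω ∂P := by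
  have h := integrable_prod_weight_mul hXm hX hV hφ hZ
  have hs := integral_integral_swap (f := fun t ω => φ t * (X t ω * Z ω)) h
  simp only [integral_const_mul] at hs
  rw [hs]
  refine integral_congr_ae (ae_of_all _ fun ω => ?_)
  simp only [processIntegral]
  rw [← integral_mul_const]
  simp only [mul_assoc]

/-- Pathwise integrals lie in the closed span of the process: by Fubini, they are orthogonal to
everything that is orthogonal to the process. -/
lemma processIntegral_mem_processSpace [IsProbabilityMeasure P]
    (hXm : Measurable fun p : ℝ × Ω => X p.1 p.2) (hX : ∀ t, MemLp (X t) 2 P)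
    (hV : ∀ t, ∫ ω, X t ω ^ 2 ∂P ≤ V) (hφ : Integrable φ)
    (hmem : MemLp (processIntegral X φ) 2 P) :
    hmem.toLp ∈ processSpace hX := by
  rw [processSpace, ← Submodule.orthogonal_orthogonal_eq_closure, Submodule.mem_orthogonal]
  intro Z hZ
  have hin : ∀ {Y : Ω → ℝ} (hY : MemLp Y 2 P), inner ℝ Z hY.toLp = ∫ ω, Y ω * Z ω ∂P := by
    intro Y hY
    rw [L2.inner_def]
    refine integral_congr_ae (hY.coeFn_toLp.mono fun ω h => ?_)
    simp [h]
  rw [hin, integral_processIntegral_mul hXm hX hV hφ (Lp.memLp Z)]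
  have h0 : ∀ t, ∫ ω, X t ω * Z ω ∂P = 0 := by
    intro t
    rw [← hin (hX t), real_inner_comm]
    exact (Submodule.mem_orthogonal _ _).1 hZ _ (Submodule.subset_span ⟨t, rfl⟩)
  simp [h0]

lemma integral_processIntegral_mul_processIntegral [IsProbabilityMeasure P]
    (hXm : Measurable fun p : ℝ × Ω => X p.1 p.2) (hX : ∀ t, MemLp (X t) 2 P)
    (hV : ∀ t, ∫ ω, X t ω ^ 2 ∂P ≤ V) (hφ : Integrable φ) {χ : ℝ → ℝ} (hχ : Integrable χ) :
    ∫ ω, processIntegral X φ ω * processIntegral X χ ω ∂P =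
      ∫ t, φ t * ∫ s, χ s * ∫ ω, X t ω * X s ω ∂P := by
  rw [integral_processIntegral_mul hXm hX hV hφ (memLp_processIntegral hXm hX hV hχ)]
  refine integral_congr_ae (ae_of_all _ fun t => ?_)
  simp only
  congr 1
  simp_rw [mul_comm (X t _)]
  rw [integral_processIntegral_mul hXm hX hV hχ (hX t)]

end ProcessIntegral

/-! ### Spectral representation of covariances -/

section Spectral

lemma integral_mul_exp_eq_conj_fourierHat (φ : ℝ → ℝ) (u : ℝ) :
    ∫ t : ℝ, (φ t : ℂ) * Complex.exp (Complex.I * u * t) =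
      (starRingEnd ℂ) (fourierHat φ u) := by
  rw [fourierHat, ← integral_conj]
  refine integral_congr_ae (ae_of_all _ fun t => ?_)
  simp only [map_mul, ← Complex.exp_conj, map_neg, Complex.conj_I, Complex.conj_ofReal]
  rw [mul_comm]
  congr 2
  ring

lemma norm_exp_neg_I_mul (x t : ℝ) : ‖Complex.exp (-(Complex.I * x * t))‖ = 1 := by
  rw [show -(Complex.I * (x : ℂ) * t) = ((-(x * t) : ℝ) : ℂ) * Complex.I by push_cast; ring,
    Complex.norm_exp_ofReal_mul_I]

lemma continuous_fourierHat {χ : ℝ → ℝ} (hχ : Integrable χ) : Continuous (fourierHat χ) := by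
  refine continuous_of_dominated (bound := fun t => |χ t|) (fun x => ?_) (fun x => ?_)
    hχ.abs (ae_of_all _ fun t => by fun_prop)
  · exact (by fun_prop : Continuous fun t : ℝ =>
      Complex.exp (-(Complex.I * x * t))).aestronglyMeasurable.mul hχ.ofReal.aestronglyMeasurable
  · refine ae_of_all _ fun t => ?_
    rw [norm_mul, Complex.norm_real, Real.norm_eq_abs, norm_exp_neg_I_mul, one_mul]

lemma norm_fourierHat_le (χ : ℝ → ℝ) (u : ℝ) : ‖fourierHat χ u‖ ≤ ∫ t, |χ t| := by
  refine (norm_integral_le_integral_norm _).trans (le_of_eq ?_)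
  refine integral_congr_ae (ae_of_all _ fun t => ?_)
  simp only [norm_mul, Complex.norm_real, Real.norm_eq_abs, norm_exp_neg_I_mul, one_mul]

/-- Covariances of pathwise integrals in the spectral domain. -/
lemma integral_integral_spectral {f φ χ : ℝ → ℝ} (hf : Integrable f) (hφ : Integrable φ)
    (hχ : Integrable χ) :
    ∫ t : ℝ, (φ t : ℂ) * ∫ s : ℝ, (χ s : ℂ) *
        ∫ u : ℝ, Complex.exp (Complex.I * u * ((t - s : ℝ) : ℂ)) * (f u : ℂ) =
      ∫ u : ℝ, (f u : ℂ) * ((starRingEnd ℂ) (fourierHat φ u) * fourierHat χ u) := by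
  -- the unimodular kernel does not affect integrability
  have hker : ∀ g : ℝ × ℝ → ℝ, Continuous g → AEStronglyMeasurable
      (fun p : ℝ × ℝ => Complex.exp (Complex.I * (g p : ℂ))) (volume.prod volume) :=
    fun g hg => (by fun_prop : Continuous fun p : ℝ × ℝ =>
      Complex.exp (Complex.I * (g p : ℂ))).aestronglyMeasurable
  have hnorm : ∀ x : ℝ, ‖Complex.exp (Complex.I * (x : ℂ))‖ = 1 := fun x => by
    rw [mul_comm, Complex.norm_exp_ofReal_mul_I]
  have hint : ∀ {a b : ℝ → ℂ} (g : ℝ × ℝ → ℝ), Continuous g → Integrable a → Integrable b →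
      Integrable (fun p : ℝ × ℝ => Complex.exp (Complex.I * (g p : ℂ)) * (a p.1 * b p.2))
        (volume.prod volume) := by
    intro a b g hg ha hb
    refine (ha.mul_prod hb).bdd_mul (c := 1) (hker g hg) (ae_of_all _ fun p => ?_)
    rw [hnorm]
  have step1 : ∀ t : ℝ, ∫ s : ℝ, (χ s : ℂ) *
        ∫ u : ℝ, Complex.exp (Complex.I * u * ((t - s : ℝ) : ℂ)) * (f u : ℂ) =
      ∫ u : ℝ, (f u : ℂ) * (Complex.exp (Complex.I * u * t) * fourierHat χ u) := by
    intro t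
    have h := integral_integral_swap (f := fun s u : ℝ =>
      Complex.exp (Complex.I * ((u * (t - s) : ℝ) : ℂ)) * ((χ s : ℂ) * (f u : ℂ)))
      (hint (a := fun s => (χ s : ℂ)) (b := fun u => (f u : ℂ))
      (fun p => p.2 * (t - p.1)) (by fun_prop) hχ.ofReal hf.ofReal)
    calc _ = ∫ s : ℝ, ∫ u : ℝ, Complex.exp (Complex.I * ((u * (t - s) : ℝ) : ℂ)) *
          ((χ s : ℂ) * (f u : ℂ)) := by
          refine integral_congr_ae (ae_of_all _ fun s => ?_)
          simp only
          rw [← integral_const_mul]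
          refine integral_congr_ae (ae_of_all _ fun u => ?_)
          simp only
          push_cast
          rw [show Complex.I * (u : ℂ) * ((t : ℂ) - s) = Complex.I * ((u : ℂ) * (t - s)) by ring]
          ring
      _ = _ := h
      _ = _ := by
          refine integral_congr_ae (ae_of_all _ fun u => ?_)
          simp only [fourierHat]
          rw [← integral_const_mul, ← integral_const_mul]
          refine integral_congr_ae (ae_of_all _ fun s => ?_)
          simp only
          rw [← mul_assoc, ← mul_assoc (Complex.exp _) (Complex.exp _), ← Complex.exp_add]
          push_cast
          rw [show Complex.I * ((u : ℂ) * (t - s)) = Complex.I * u * t + -(Complex.I * u * s) by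
            ring]
          ring
  simp_rw [step1]
  have hbdd : Integrable fun u => (f u : ℂ) * fourierHat χ u :=
    hf.ofReal.mul_bdd (c := ∫ t, |χ t|) (continuous_fourierHat hχ).aestronglyMeasurable
      (ae_of_all _ (norm_fourierHat_le χ))
  have h := integral_integral_swap (f := fun t u : ℝ =>
    Complex.exp (Complex.I * ((u * t : ℝ) : ℂ)) * ((φ t : ℂ) * ((f u : ℂ) * fourierHat χ u)))
    (hint (a := fun t => (φ t : ℂ))
    (b := fun u => (f u : ℂ) * fourierHat χ u)
    (fun p => p.2 * p.1) (by fun_prop) hφ.ofReal hbdd)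
  calc _ = ∫ t : ℝ, ∫ u : ℝ, Complex.exp (Complex.I * ((u * t : ℝ) : ℂ)) *
          ((φ t : ℂ) * ((f u : ℂ) * fourierHat χ u)) := by
        refine integral_congr_ae (ae_of_all _ fun t => ?_)
        simp only
        rw [← integral_const_mul]
        refine integral_congr_ae (ae_of_all _ fun u => ?_)
        simp only
        push_cast
        rw [← mul_assoc Complex.I]
        ring
    _ = _ := h
    _ = _ := by
        refine integral_congr_ae (ae_of_all _ fun u => ?_)
        simp only
        rw [← integral_mul_exp_eq_conj_fourierHat, ← integral_mul_const, ← integral_const_mul]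
        refine integral_congr_ae (ae_of_all _ fun t => ?_)
        simp only
        push_cast
        rw [← mul_assoc Complex.I]
        ring

end Spectral

/-! ### A central limit theorem for weighted sums of squared Gaussian variables -/

section QuadraticCLT

lemma norm_prod_sub_prod_le_sum {ι : Type*} (s : Finset ι) (f g : ι → ℂ)
    (hf : ∀ i ∈ s, ‖f i‖ ≤ 1) (hg : ∀ i ∈ s, ‖g i‖ ≤ 1) :
    ‖∏ i ∈ s, f i - ∏ i ∈ s, g i‖ ≤ ∑ i ∈ s, ‖f i - g i‖ := by
  classical
  induction s using Finset.induction_on with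
  | empty => simp
  | insert a s ha ih =>
    rw [Finset.prod_insert ha, Finset.prod_insert ha, Finset.sum_insert ha]
    have h1 : ‖∏ i ∈ s, f i‖ ≤ 1 := by
      rw [norm_prod]
      exact Finset.prod_le_one (fun _ _ => norm_nonneg _)
        fun i hi => hf i (Finset.mem_insert_of_mem hi)
    have h2 := ih (fun i hi => hf i (Finset.mem_insert_of_mem hi))
      fun i hi => hg i (Finset.mem_insert_of_mem hi)
    have h3 : ‖g a‖ ≤ 1 := hg a (Finset.mem_insert_self _ _)
    calc ‖f a * ∏ i ∈ s, f i - g a * ∏ i ∈ s, g i‖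
        = ‖(f a - g a) * ∏ i ∈ s, f i + g a * (∏ i ∈ s, f i - ∏ i ∈ s, g i)‖ := by
          congr 1; ring
      _ ≤ ‖f a - g a‖ * ‖∏ i ∈ s, f i‖ + ‖g a‖ * ‖∏ i ∈ s, f i - ∏ i ∈ s, g i‖ := by
          refine (norm_add_le _ _).trans ?_
          rw [norm_mul, norm_mul]
      _ ≤ ‖f a - g a‖ * 1 + 1 * ‖∏ i ∈ s, f i - ∏ i ∈ s, g i‖ := by gcongr
      _ ≤ _ := by linarith

/-- If `φ(x) = 1 - x²/2 + o(x²)` has modulus at most one, products of values of `φ` along a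
uniformly small array with `∑ x_i² → τ` converge to `e^{-τ/2}`. -/
lemma tendsto_prod_of_taylor_two {φ : ℝ → ℂ} (hφ1 : ∀ x, ‖φ x‖ ≤ 1)
    (hφ : (fun x : ℝ => φ x - (1 - (x : ℂ) ^ 2 / 2)) =o[𝓝 0] fun x : ℝ => x ^ 2)
    {ι : ℕ → Type*} [∀ j, Fintype (ι j)] (x : ∀ j, ι j → ℝ) {τ : ℝ}
    (hsum : Tendsto (fun j => ∑ i, x j i ^ 2) atTop (𝓝 τ))
    (hmax : ∀ ε > 0, ∀ᶠ j in atTop, ∀ i, |x j i| ≤ ε) :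
    Tendsto (fun j => ∏ i, φ (x j i)) atTop (𝓝 (Complex.exp (-(τ : ℂ) / 2))) := by
  have hexp : (fun x : ℝ => Complex.exp (-(x : ℂ) ^ 2 / 2) - (1 - (x : ℂ) ^ 2 / 2)) =o[𝓝 0]
      fun x : ℝ => x ^ 2 := by
    have h1 : (fun z : ℂ => Complex.exp z - 1 - z) =o[𝓝 0] fun z : ℂ => z := by
      have := (Complex.hasDerivAt_exp 0).isLittleO
      simpa using this
    have h2 : Tendsto (fun x : ℝ => -(x : ℂ) ^ 2 / 2) (𝓝 0) (𝓝 0) := by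
      have : Continuous fun x : ℝ => -(x : ℂ) ^ 2 / 2 := by fun_prop
      simpa using this.tendsto 0
    have h3 := h1.comp_tendsto h2
    have h4 : (fun x : ℝ => -(x : ℂ) ^ 2 / 2) =O[𝓝 0] fun x : ℝ => x ^ 2 := by
      refine Asymptotics.IsBigO.of_bound 1 (Eventually.of_forall fun x => ?_)
      simp only [norm_div, norm_neg, norm_pow, Complex.norm_real, Real.norm_eq_abs, sq_abs,
        RCLike.norm_ofNat, one_mul]
      linarith [sq_nonneg x]
    refine (h3.trans_isBigO h4).congr_left fun x => ?_
    simp only [Function.comp]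
    ring
  -- replacing each factor `φ x` by `e^{-x²/2}` costs `o(x²)`, which is summed by telescoping
  have hdiff := (hφ.sub hexp).congr_left
    (f₂ := fun x : ℝ => φ x - Complex.exp (-(x : ℂ) ^ 2 / 2)) fun x => by ring
  have hgauss : Tendsto (fun j => ∏ i, Complex.exp (-(x j i : ℂ) ^ 2 / 2)) atTop
      (𝓝 (Complex.exp (-(τ : ℂ) / 2))) := by
    have : ∀ j, ∏ i, Complex.exp (-(x j i : ℂ) ^ 2 / 2) =
        Complex.exp (-((∑ i, x j i ^ 2 : ℝ) : ℂ) / 2) := by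
      intro j
      rw [← Complex.exp_sum]
      congr 1
      push_cast
      rw [← Finset.sum_div, Finset.sum_neg_distrib]
    simp_rw [this]
    have hc : Continuous fun y : ℝ => Complex.exp (-(y : ℂ) / 2) := by fun_prop
    exact (hc.tendsto τ).comp hsum
  have hzero : Tendsto (fun j => ∏ i, φ (x j i) - ∏ i, Complex.exp (-(x j i : ℂ) ^ 2 / 2)) atTop
      (𝓝 0) := by
    rw [Metric.tendsto_nhds]
    intro ε hε
    set ε' := ε / (2 * (|τ| + 1)) with hε'
    have hε'0 : 0 < ε' := by positivity
    have hloc := hdiff.def hε'0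
    rw [Metric.eventually_nhds_iff] at hloc
    obtain ⟨δ, hδ, hloc⟩ := hloc
    have hbd : ∀ᶠ j in atTop, ∑ i, x j i ^ 2 ≤ |τ| + 1 :=
      (hsum.eventually_le_const (by linarith [le_abs_self τ] : τ < |τ| + 1))
    filter_upwards [hmax (δ / 2) (by positivity), hbd] with j hj hbj
    rw [dist_zero_right]
    calc _ ≤ ∑ i, ‖φ (x j i) - Complex.exp (-(x j i : ℂ) ^ 2 / 2)‖ := by
          refine norm_prod_sub_prod_le_sum _ _ _ (fun i _ => hφ1 _) fun i _ => ?_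
          rw [Complex.norm_exp, Real.exp_le_one_iff]
          have : -(x j i : ℂ) ^ 2 / 2 = ((-(x j i) ^ 2 / 2 : ℝ) : ℂ) := by push_cast; ring
          rw [this, Complex.ofReal_re]
          nlinarith [sq_nonneg (x j i)]
      _ ≤ ∑ i, ε' * x j i ^ 2 := by
          refine Finset.sum_le_sum fun i _ => ?_
          have := hloc (y := x j i) (by
            rw [Real.dist_eq, sub_zero]
            linarith [hj i])
          simpa using this
      _ = ε' * ∑ i, x j i ^ 2 := by rw [Finset.mul_sum]
      _ ≤ ε' * (|τ| + 1) := by gcongr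
      _ = ε / 2 := by rw [hε']; field_simp
      _ < ε := by linarith
  simpa using hzero.add hgauss

lemma integral_pow_four_gaussianReal : ∫ x, x ^ 4 ∂(gaussianReal 0 1) = 3 := by
  have h := iteratedDeriv_mgf_zero (X := id) (μ := gaussianReal 0 1)
    (by simp [integrableExpSet_id_gaussianReal]) 4
  have h0 : mgf id (gaussianReal 0 1) = fun t => Real.exp (t ^ 2 / 2) := by
    rw [mgf_id_gaussianReal]; funext t; simp
  have hd : ∀ (p q : ℝ → ℝ) (_ : ∀ t, HasDerivAt p (q t - t * p t) t),
      deriv (fun t => p t * Real.exp (t ^ 2 / 2)) = fun t => q t * Real.exp (t ^ 2 / 2) := by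
    intro p q hp
    funext t
    have he : HasDerivAt (fun t : ℝ => Real.exp (t ^ 2 / 2)) (Real.exp (t ^ 2 / 2) * t) t := by
      have : HasDerivAt (fun t : ℝ => t ^ 2 / 2) t t := by
        have := ((hasDerivAt_id t).pow 2).div_const 2
        simpa using this
      exact this.exp
    have h1 : deriv (fun t => p t * Real.exp (t ^ 2 / 2)) t = _ := ((hp t).mul he).deriv
    rw [h1]
    ring
  have hp : ∀ (n : ℕ) (t : ℝ), HasDerivAt (fun t : ℝ => t ^ n) (n * t ^ (n - 1)) t :=
    fun n t => hasDerivAt_pow n t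
  have d1 : deriv (fun t : ℝ => Real.exp (t ^ 2 / 2)) = fun t => t * Real.exp (t ^ 2 / 2) := by
    have := hd (fun _ => 1) (fun t => t) fun t => by simpa using hasDerivAt_const t (1 : ℝ)
    simpa using this
  have d2 : deriv (fun t : ℝ => t * Real.exp (t ^ 2 / 2)) =
      fun t => (1 + t ^ 2) * Real.exp (t ^ 2 / 2) :=
    hd (fun t => t) _ fun t => by
      exact (hasDerivAt_id' t).congr_deriv (by ring)
  have d3 : deriv (fun t : ℝ => (1 + t ^ 2) * Real.exp (t ^ 2 / 2)) =
      fun t => (3 * t + t ^ 3) * Real.exp (t ^ 2 / 2) :=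
    hd (fun t => 1 + t ^ 2) _ fun t => by
      exact ((hp 2 t).const_add 1).congr_deriv (by norm_num; ring)
  have d4 : deriv (fun t : ℝ => (3 * t + t ^ 3) * Real.exp (t ^ 2 / 2)) =
      fun t => (3 + 6 * t ^ 2 + t ^ 4) * Real.exp (t ^ 2 / 2) :=
    hd (fun t => 3 * t + t ^ 3) _ fun t => by
      exact (((hasDerivAt_id' t).const_mul 3).add (hp 3 t)).congr_deriv (by norm_num; ring)
  rw [h0, iteratedDeriv_succ, iteratedDeriv_succ, iteratedDeriv_succ, iteratedDeriv_one, d1, d2,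
    d3, d4] at h
  simpa using h.symm

lemma integrable_pow_gaussianReal (n : ℕ) : Integrable (fun x => x ^ n) (gaussianReal 0 1) := by
  have := (memLp_id_gaussianReal (μ := 0) (v := 1) n).integrable_norm_pow'
  refine this.mono' (by fun_prop) (ae_of_all _ fun x => ?_)
  simp

lemma integral_sq_gaussianReal : ∫ x, x ^ 2 ∂(gaussianReal 0 1) = 1 := by
  have := variance_fun_id_gaussianReal (μ := 0) (v := 1)
  rw [variance_of_integral_eq_zero (by fun_prop) (by simp)] at this
  simpa using this

/-- The characteristic function of `(ξ² - 1)/√2` for a standard Gaussian `ξ`. -/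
noncomputable def chiSquareCharFun (t : ℝ) : ℂ :=
  charFun ((gaussianReal 0 1).map fun x => (x ^ 2 - 1) / √2) t

lemma norm_chiSquareCharFun_le_one (t : ℝ) : ‖chiSquareCharFun t‖ ≤ 1 := by
  have : IsProbabilityMeasure ((gaussianReal 0 1).map fun x => (x ^ 2 - 1) / √2) :=
    Measure.isProbabilityMeasure_map (by fun_prop)
  exact norm_charFun_le_one t

lemma chiSquareCharFun_taylor :
    (fun x : ℝ => chiSquareCharFun x - (1 - (x : ℂ) ^ 2 / 2)) =o[𝓝 0] fun x : ℝ => x ^ 2 := by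
  refine taylor_charFun_two (by fun_prop) ?_ ?_
  · rw [integral_div, integral_sub (integrable_pow_gaussianReal 2) (integrable_const _),
      integral_sq_gaussianReal]
    simp
  · have : ∀ x : ℝ, ((fun x : ℝ => (x ^ 2 - 1) / √2) ^ 2) x = (x ^ 4 - 2 * x ^ 2 + 1) / 2 := by
      intro x
      simp only [Pi.pow_apply, div_pow, Real.sq_sqrt (by norm_num : (0 : ℝ) ≤ 2)]
      ring
    simp_rw [this]
    have h2 := (integrable_pow_gaussianReal 2).const_mul 2
    have h42 : Integrable (fun x : ℝ => x ^ 4 - 2 * x ^ 2) (gaussianReal 0 1) :=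
      (integrable_pow_gaussianReal 4).sub h2
    rw [integral_div, integral_add h42 (integrable_const _),
      integral_sub (integrable_pow_gaussianReal 4) h2,
      integral_const_mul, integral_pow_four_gaussianReal, integral_sq_gaussianReal]
    simp
    norm_num

variable {Ω : Type*} [MeasurableSpace Ω] {P : Measure Ω}

lemma charFun_map_weight_mul_sq_sub {Y : Ω → ℝ} {v : ℝ} (hv : 0 ≤ v)
    (hY : HasLaw Y (gaussianReal 0 v.toNNReal) P) (w t : ℝ) :
    charFun (P.map fun ω => w * (Y ω ^ 2 - v)) t = chiSquareCharFun (t * (√2 * (w * v))) := by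
  have h1 : P.map (fun ω => w * (Y ω ^ 2 - v)) =
      ((gaussianReal 0 1).map fun x => (√2 * (w * v)) * ((x ^ 2 - 1) / √2)) := by
    have h2 : gaussianReal 0 v.toNNReal = (gaussianReal 0 1).map fun x => √v * x := by
      rw [gaussianReal_map_const_mul]
      congr 1
      · simp
      · ext; simp [Real.sq_sqrt hv, hv]
    have h3 : (fun ω => w * (Y ω ^ 2 - v)) = (fun y => w * (y ^ 2 - v)) ∘ Y := rfl
    rw [h3, ← AEMeasurable.map_map_of_aemeasurable (by fun_prop) hY.aemeasurable, hY.map_eq, h2,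
      AEMeasurable.map_map_of_aemeasurable (by fun_prop) (by fun_prop)]
    congr 1
    funext x
    simp only [Function.comp_apply, mul_pow, Real.sq_sqrt hv]
    field_simp
  rw [h1, charFun_map_mul_comp (by fun_prop), chiSquareCharFun, mul_comm]

/-- The central limit theorem for weighted sums `∑ w_i (Y_i² - v_i)` of squares of independent
centred Gaussian variables of variances `v_i`, in terms of characteristic functions. -/
theorem tendsto_charFun_sum_weight_mul_sq_sub {ι : ℕ → Type*} [∀ j, Fintype (ι j)]
    (Y : ∀ j, ι j → Ω → ℝ) (v w : ∀ j, ι j → ℝ) {τ : ℝ}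
    (hY : ∀ᶠ j in atTop, iIndepFun (Y j) P ∧ ∀ i, 0 ≤ v j i ∧
      HasLaw (Y j i) (gaussianReal 0 (v j i).toNNReal) P)
    (hsum : Tendsto (fun j => ∑ i, 2 * (w j i * v j i) ^ 2) atTop (𝓝 τ))
    (hmax : ∀ ε > 0, ∀ᶠ j in atTop, ∀ i, |w j i * v j i| ≤ ε) (t : ℝ) :
    Tendsto (fun j => charFun (P.map fun ω => ∑ i, w j i * (Y j i ω ^ 2 - v j i)) t) atTop
      (𝓝 (Complex.exp (-((τ * t ^ 2 : ℝ) : ℂ) / 2))) := by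
  have key := tendsto_prod_of_taylor_two norm_chiSquareCharFun_le_one chiSquareCharFun_taylor
    (fun j i => t * (√2 * (w j i * v j i))) (τ := τ * t ^ 2) ?_ ?_
  · refine key.congr' ?_
    filter_upwards [hY] with j ⟨hind, hlaw⟩
    have hind' := hind.comp (fun i y => w j i * (y ^ 2 - v j i)) fun i => by fun_prop
    have := hind'.charFun_map_fun_sum_eq_prod (fun i => by
      have := (hlaw i).2.aemeasurable
      simp only [Function.comp_def]
      fun_prop)
    simp only [Function.comp_def] at this
    rw [this, Finset.prod_apply]
    exact Finset.prod_congr rfl fun i _ =>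
      (charFun_map_weight_mul_sq_sub (hlaw i).1 (hlaw i).2 _ _).symm
  · refine (hsum.mul_const (t ^ 2)).congr fun j => ?_
    rw [Finset.sum_mul]
    refine Finset.sum_congr rfl fun i _ => ?_
    rw [mul_pow t, mul_pow √2, Real.sq_sqrt (by norm_num)]
    ring
  · intro ε hε
    filter_upwards [hmax (ε / (|t| * √2 + 1)) (by positivity)] with j hj i
    rw [abs_mul, abs_mul, abs_of_nonneg (Real.sqrt_nonneg 2), ← mul_assoc]
    calc |t| * √2 * |w j i * v j i| ≤ |t| * √2 * (ε / (|t| * √2 + 1)) := by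
          gcongr; exact hj i
      _ = ε * ((|t| * √2) / (|t| * √2 + 1)) := by ring
      _ ≤ ε * 1 := by
          gcongr
          rw [div_le_one (by positivity)]
          linarith
      _ = ε := mul_one _

end QuadraticCLT

/-! ### Diagonalisation of covariance matrices -/

section Diagonalisation

variable {ι : Type*} [Fintype ι] [DecidableEq ι]

lemma sum_sq_sum_eigenvectorBasis_mul {R : Matrix ι ι ℝ} (hR : R.IsHermitian) (z : ι → ℝ) :
    ∑ i, (∑ k, hR.eigenvectorBasis i k * z k) ^ 2 = ∑ k, z k ^ 2 := by
  have h := hR.eigenvectorBasis.sum_sq_norm_inner_right (WithLp.toLp 2 z)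
  rw [EuclideanSpace.norm_sq_eq] at h
  simp only [Real.norm_eq_abs, sq_abs] at h
  rw [← h]
  refine Finset.sum_congr rfl fun i _ => ?_
  congr 1
  simp [PiLp.inner_apply, mul_comm]

lemma sum_mul_eigenvectorBasis {R : Matrix ι ι ℝ} (hR : R.IsHermitian) (i k : ι) :
    ∑ l, R k l * hR.eigenvectorBasis i l = hR.eigenvalues i * hR.eigenvectorBasis i k := by
  have h := congrFun (hR.mulVec_eigenvectorBasis i) k
  simpa [Matrix.mulVec, dotProduct] using h

lemma sum_eigenvectorBasis_mul_eigenvectorBasis {R : Matrix ι ι ℝ} (hR : R.IsHermitian)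
    (i j : ι) :
    ∑ k, hR.eigenvectorBasis i k * hR.eigenvectorBasis j k = if i = j then 1 else 0 := by
  have h := orthonormal_iff_ite.1 hR.eigenvectorBasis.orthonormal j i
  simp only [PiLp.inner_apply, RCLike.inner_apply, conj_trivial] at h
  rw [h]
  simp [eq_comm]

lemma sum_sum_eigenvectorBasis_mul {R : Matrix ι ι ℝ} (hR : R.IsHermitian) (i j : ι) :
    ∑ k, ∑ l, hR.eigenvectorBasis i k * hR.eigenvectorBasis j l * R k l =
      if i = j then hR.eigenvalues i else 0 := by
  have h1 : ∀ k, ∑ l, hR.eigenvectorBasis i k * hR.eigenvectorBasis j l * R k l =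
      hR.eigenvalues j * (hR.eigenvectorBasis i k * hR.eigenvectorBasis j k) := by
    intro k
    rw [mul_left_comm, ← sum_mul_eigenvectorBasis, Finset.mul_sum]
    exact Finset.sum_congr rfl fun l _ => by ring
  simp_rw [h1]
  rw [← Finset.mul_sum, sum_eigenvectorBasis_mul_eigenvectorBasis]
  split_ifs with h <;> simp [h]

lemma sum_sq_eigenvalues {R : Matrix ι ι ℝ} (hR : R.IsHermitian) :
    ∑ i, hR.eigenvalues i ^ 2 = ∑ k, ∑ l, R k l ^ 2 := by
  calc ∑ i, hR.eigenvalues i ^ 2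
      = ∑ i, ∑ k, (∑ l, hR.eigenvectorBasis i l * R k l) ^ 2 := by
        refine Finset.sum_congr rfl fun i _ => ?_
        have h1 : ∀ k, ∑ l, hR.eigenvectorBasis i l * R k l =
            hR.eigenvalues i * hR.eigenvectorBasis i k := fun k => by
          rw [← sum_mul_eigenvectorBasis]
          exact Finset.sum_congr rfl fun l _ => mul_comm _ _
        have h2 := sum_eigenvectorBasis_mul_eigenvectorBasis hR i i
        rw [if_pos rfl] at h2
        simp_rw [h1, mul_pow]
        rw [← Finset.mul_sum]
        simp_rw [sq (hR.eigenvectorBasis i _)]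
        rw [h2, mul_one]
    _ = ∑ k, ∑ i, (∑ l, hR.eigenvectorBasis i l * R k l) ^ 2 := Finset.sum_comm
    _ = _ := Finset.sum_congr rfl fun k _ => sum_sq_sum_eigenvectorBasis_mul hR _

variable {Ω : Type*} [MeasurableSpace Ω] {P : Measure Ω}

/-- A finite collection of families `Z κ` of jointly Gaussian variables, uncorrelated for
different `κ`, can be rotated within each family into independent variables, with the same sums of
squares. The variances of the latter are the eigenvalues of the covariance matrices. -/
theorem exists_independent_rotation [IsProbabilityMeasure P] {K : Type*} [Fintype K]
    [DecidableEq K] {Z : K → ι → Ω → ℝ} {R : K → Matrix ι ι ℝ}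
    (hG : HasGaussianLaw (fun ω (p : K × ι) => Z p.1 p.2 ω) P)
    (h0 : ∀ κ k, ∫ ω, Z κ k ω ∂P = 0)
    (hcov : ∀ κ k l, ∫ ω, Z κ k ω * Z κ l ω ∂P = R κ k l)
    (hcross : ∀ κ κ', κ ≠ κ' → ∀ k l, ∫ ω, Z κ k ω * Z κ' l ω ∂P = 0) :
    ∃ (Y : K × ι → Ω → ℝ) (v : K × ι → ℝ), iIndepFun Y P ∧
      (∀ p, 0 ≤ v p ∧ HasLaw (Y p) (gaussianReal 0 (v p).toNNReal) P) ∧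
      (∀ κ ω, ∑ i, Y (κ, i) ω ^ 2 = ∑ k, Z κ k ω ^ 2) ∧
      (∀ κ, ∑ i, v (κ, i) = ∑ k, R κ k k) ∧
      (∀ κ, ∑ i, v (κ, i) ^ 2 = ∑ k, ∑ l, R κ k l ^ 2) ∧
      ∀ κ C, (∀ x : ι → ℝ, ∑ k, ∑ l, x k * x l * R κ k l ≤ C * ∑ k, x k ^ 2) →
        ∀ i, v (κ, i) ≤ C := by
  have hR : ∀ κ, (R κ).IsHermitian := fun κ => by
    ext k l
    simp only [Matrix.conjTranspose_apply, star_trivial, ← hcov]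
    simp_rw [mul_comm]
  have hmem : ∀ κ k, MemLp (Z κ k) 2 P := fun κ k => (hG.eval (κ, k)).memLp_two
  -- the coordinates of `Z κ` in an orthonormal eigenbasis of its covariance matrix
  set Y : K × ι → Ω → ℝ := fun p ω => ∑ k, (hR p.1).eigenvectorBasis p.2 k * Z p.1 k ω with hY
  have hYG : HasGaussianLaw (fun ω p => Y p ω) P := by
    let L : (K × ι → ℝ) →L[ℝ] (K × ι → ℝ) := ContinuousLinearMap.pi fun p =>
      ∑ k, (hR p.1).eigenvectorBasis p.2 k • ContinuousLinearMap.proj (p.1, k)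
    have := hG.map_fun L
    refine (iff_of_eq ?_).mp this
    congr 1
    funext ω p
    simp [L, hY]
  have hYmem : ∀ p, MemLp (Y p) 2 P := fun p => (hYG.eval p).memLp_two
  have hY0 : ∀ p, ∫ ω, Y p ω ∂P = 0 := fun p => by
    simp only [hY]
    rw [integral_finsetSum _ fun k _ => ((hmem p.1 k).integrable (by norm_num)).const_mul _]
    exact Finset.sum_eq_zero fun k _ => by rw [integral_const_mul, h0, mul_zero]
  have hprod : ∀ p q, ∫ ω, Y p ω * Y q ω ∂P = ∑ k, ∑ l, (hR p.1).eigenvectorBasis p.2 k *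
      (hR q.1).eigenvectorBasis q.2 l * ∫ ω, Z p.1 k ω * Z q.1 l ω ∂P := by
    intro p q
    have hi : ∀ k l, Integrable (fun ω => (hR p.1).eigenvectorBasis p.2 k *
        (hR q.1).eigenvectorBasis q.2 l * (Z p.1 k ω * Z q.1 l ω)) P := fun k l =>
      ((hmem p.1 k).integrable_mul (hmem q.1 l)).const_mul _
    simp_rw [← integral_const_mul]
    simp_rw [← integral_finsetSum Finset.univ fun l _ => hi _ l]
    rw [← integral_finsetSum Finset.univ fun k _ => integrable_finsetSum _ fun l _ => hi k l]
    refine integral_congr_ae (ae_of_all _ fun ω => ?_)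
    simp only [hY, Finset.sum_mul_sum]
    exact Finset.sum_congr rfl fun k _ => Finset.sum_congr rfl fun l _ => by ring
  have hsame : ∀ κ i j, ∫ ω, Y (κ, i) ω * Y (κ, j) ω ∂P =
      if i = j then (hR κ).eigenvalues i else 0 := by
    intro κ i j
    rw [hprod]
    simp_rw [hcov]
    exact sum_sum_eigenvectorBasis_mul (hR κ) i j
  have hvar : ∀ p, ∫ ω, Y p ω ^ 2 ∂P = (hR p.1).eigenvalues p.2 := by
    rintro ⟨κ, i⟩
    have := hsame κ i i
    rw [if_pos rfl] at this
    rw [← this]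
    simp_rw [sq]
  refine ⟨Y, fun p => (hR p.1).eigenvalues p.2, ?_, fun p => ⟨?_, ?_, ?_⟩, ?_, ?_, ?_, ?_⟩
  · refine hYG.iIndepFun_of_covariance_eq_zero ?_
    rintro ⟨κ, i⟩ ⟨κ', j⟩ hne
    rw [covariance_eq_sub (hYmem _) (hYmem _), hY0, zero_mul, sub_zero]
    simp only [Pi.mul_apply]
    by_cases hκ : κ = κ'
    · subst hκ
      rw [hsame, if_neg (by rintro rfl; exact hne rfl)]
    · rw [hprod]
      simp [hcross κ κ' hκ]
  · show 0 ≤ (hR p.1).eigenvalues p.2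
    rw [← hvar]
    exact integral_nonneg fun _ => sq_nonneg _
  · exact (hYmem p).aestronglyMeasurable.aemeasurable
  · rw [(hYG.eval p).map_eq_gaussianReal, hY0, variance_of_integral_eq_zero
      (hYmem p).aestronglyMeasurable.aemeasurable (hY0 p), hvar]
  · exact fun κ ω => sum_sq_sum_eigenvectorBasis_mul (hR κ) fun k => Z κ k ω
  · intro κ
    have := (hR κ).trace_eq_sum_eigenvalues
    simpa [Matrix.trace] using this.symm
  · exact fun κ => sum_sq_eigenvalues (hR κ)
  · intro κ C hC i
    have h1 := hC fun k => (hR κ).eigenvectorBasis i k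
    rw [sum_sum_eigenvectorBasis_mul, if_pos rfl] at h1
    simp_rw [sq] at h1
    rwa [sum_eigenvectorBasis_mul_eigenvectorBasis, if_pos rfl, mul_one] at h1

/-- The central limit theorem for weighted sums of squares of jointly Gaussian families that are
uncorrelated with each other: the variances of the sums have to converge and the weighted
covariance forms have to be asymptotically negligible. -/
theorem tendsto_charFun_sum_weight_mul_sum_sq [IsProbabilityMeasure P] {K : Type*} [Fintype K]
    [DecidableEq K] {n : ℕ → ℕ} {Z : ∀ j, K → Fin (n j) → Ω → ℝ}
    {R : ∀ j, K → Matrix (Fin (n j)) (Fin (n j)) ℝ} (w : ℕ → K → ℝ) {τ : ℝ}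
    (hZ : ∀ᶠ j in atTop, HasGaussianLaw (fun ω (p : K × Fin (n j)) => Z j p.1 p.2 ω) P ∧
      (∀ κ k, ∫ ω, Z j κ k ω ∂P = 0) ∧
      (∀ κ k l, ∫ ω, Z j κ k ω * Z j κ l ω ∂P = R j κ k l) ∧
      ∀ κ κ', κ ≠ κ' → ∀ k l, ∫ ω, Z j κ k ω * Z j κ' l ω ∂P = 0)
    (hsum : Tendsto (fun j => ∑ κ, 2 * w j κ ^ 2 * ∑ k, ∑ l, R j κ k l ^ 2) atTop (𝓝 τ))
    (hmax : ∀ ε > 0, ∀ᶠ j in atTop, ∀ κ, ∃ C, |w j κ| * C ≤ ε ∧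
      ∀ x : Fin (n j) → ℝ, ∑ k, ∑ l, x k * x l * R j κ k l ≤ C * ∑ k, x k ^ 2) (t : ℝ) :
    Tendsto (fun j => charFun (P.map fun ω => ∑ κ, w j κ *
      (∑ k, Z j κ k ω ^ 2 - ∑ k, R j κ k k)) t) atTop
      (𝓝 (Complex.exp (-((τ * t ^ 2 : ℝ) : ℂ) / 2))) := by
  obtain ⟨j₁, hj₁⟩ := eventually_atTop.1 hZ
  have hrot := fun j (hj : j₁ ≤ j) => exists_independent_rotation (Z := Z j) (R := R j)
    (hj₁ j hj).1 (hj₁ j hj).2.1 (hj₁ j hj).2.2.1 (hj₁ j hj).2.2.2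
  choose! Y v hind hlaw hsq htr htr2 hform using hrot
  have hpsum : ∀ j (F : K × Fin (n j) → ℝ), ∑ p, F p = ∑ κ, ∑ i, F (κ, i) := fun j F => by
    rw [← Finset.univ_product_univ, Finset.sum_product]
  refine (tendsto_charFun_sum_weight_mul_sq_sub (P := P) Y v (fun j p => w j p.1) (τ := τ)
    ?_ ?_ ?_ t).congr' ?_
  · filter_upwards [eventually_ge_atTop j₁] with j hj using ⟨hind j hj, hlaw j hj⟩
  · refine hsum.congr' ?_
    filter_upwards [eventually_ge_atTop j₁] with j hj
    rw [hpsum]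
    refine Finset.sum_congr rfl fun κ _ => ?_
    rw [← htr2 j hj, Finset.mul_sum]
    exact Finset.sum_congr rfl fun i _ => by ring
  · intro ε hε
    filter_upwards [eventually_ge_atTop j₁, hmax ε hε] with j hj hC p
    obtain ⟨C, hC1, hC2⟩ := hC p.1
    rw [abs_mul, abs_of_nonneg (hlaw j hj p).1]
    exact (mul_le_mul_of_nonneg_left (hform j hj p.1 C hC2 p.2) (abs_nonneg _)).trans hC1
  · filter_upwards [eventually_ge_atTop j₁] with j hj
    congr 2
    funext ω
    rw [hpsum]
    refine Finset.sum_congr rfl fun κ _ => ?_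
    rw [← hsq j hj, ← htr j hj, ← Finset.sum_sub_distrib, Finset.mul_sum]

end Diagonalisation

/-! ### Fourier coefficients of periodised functions -/

section CosCoeff

/-- The cosine transform `∫ p(θ) cos(2πnθ) dθ` at an integer frequency. For an even function it is
the `n`-th Fourier coefficient of the periodisation `∑_k p(θ + k)`. -/
noncomputable def cosCoeff (p : ℝ → ℝ) (n : ℤ) : ℝ :=
  ∫ θ, p θ * Real.cos (2 * Real.pi * n * θ)

variable {p q : ℝ → ℝ} {N : ℕ}

lemma integrable_of_continuous_of_support (hp : Continuous p) (hs : ∀ x, (N : ℝ) < |x| → p x = 0) :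
    Integrable p := by
  refine hp.integrable_of_hasCompactSupport
    (HasCompactSupport.intro (isCompact_Icc (a := -(N : ℝ)) (b := N)) ?_)
  intro x hx
  refine hs x (not_le.1 fun h => hx (abs_le.1 h))

lemma integrable_mul_cos (hp : Integrable p) (n : ℤ) :
    Integrable fun θ => p θ * Real.cos (2 * Real.pi * n * θ) := by
  refine hp.mul_bdd (c := 1) (by fun_prop) (ae_of_all _ fun θ => ?_)
  exact Real.abs_cos_le_one _

lemma cosCoeff_sub (hp : Integrable p) (hq : Integrable q) (n : ℤ) :
    cosCoeff (fun x => p x - q x) n = cosCoeff p n - cosCoeff q n := by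
  simp only [cosCoeff, sub_mul]
  exact integral_sub (integrable_mul_cos hp n) (integrable_mul_cos hq n)

lemma integral_exp_mul_eq_cosCoeff (hp : Integrable p) (he : ∀ x, p (-x) = p x) (n : ℤ) :
    ∫ x : ℝ, Complex.exp (-(2 * Real.pi * Complex.I * n * x)) * (p x : ℂ) = cosCoeff p n := by
  have hsin : Integrable fun θ => p θ * Real.sin (2 * Real.pi * n * θ) := by
    refine hp.mul_bdd (c := 1) (by fun_prop) (ae_of_all _ fun θ => ?_)
    exact Real.abs_sin_le_one _
  have hzero : ∫ θ, p θ * Real.sin (2 * Real.pi * n * θ) = 0 := by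
    have h := integral_neg_eq_self (fun θ => p θ * Real.sin (2 * Real.pi * n * θ)) volume
    have h2 : ∀ θ : ℝ, p (-θ) * Real.sin (2 * Real.pi * n * -θ) =
        -(p θ * Real.sin (2 * Real.pi * n * θ)) := fun θ => by
      rw [he, mul_neg, Real.sin_neg, mul_neg]
    simp_rw [h2, integral_neg] at h
    linarith
  have h1 : ∀ x : ℝ, Complex.exp (-(2 * Real.pi * Complex.I * n * x)) * (p x : ℂ) =
      ((p x * Real.cos (2 * Real.pi * n * x) : ℝ) : ℂ) -
        Complex.I * ((p x * Real.sin (2 * Real.pi * n * x) : ℝ) : ℂ) := by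
    intro x
    have : -(2 * (Real.pi : ℂ) * Complex.I * n * x) =
        ((-(2 * Real.pi * n * x) : ℝ) : ℂ) * Complex.I := by push_cast; ring
    rw [this, Complex.exp_mul_I, ← Complex.ofReal_cos, ← Complex.ofReal_sin, Real.cos_neg,
      Real.sin_neg]
    push_cast
    ring
  simp_rw [h1]
  rw [integral_sub (integrable_mul_cos hp n).ofReal (hsin.ofReal.const_mul _), integral_const_mul,
    integral_complex_ofReal, integral_complex_ofReal, hzero]
  simp [cosCoeff]

/-- On `[0, 1]` the periodisation of a function supported in `[-N, N]` is a fixed finite sum. -/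
lemma tsum_comp_add_eq_sum (hs : ∀ x, (N : ℝ) < |x| → p x = 0) {x : ℝ} (hx : x ∈ Icc (0 : ℝ) 1) :
    ∑' k : ℤ, p (x + k) = ∑ k ∈ Finset.Icc (-(N + 1) : ℤ) N, p (x + k) := by
  refine tsum_eq_sum fun k hk => hs _ ?_
  rw [Finset.mem_Icc, not_and_or, not_le, not_le] at hk
  rcases hk with hk | hk
  · have : (k : ℝ) + 1 ≤ -(N + 1) := by exact_mod_cast hk
    rw [lt_abs]; right; linarith [hx.2]
  · have : (N : ℝ) + 1 ≤ k := by exact_mod_cast hk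
    rw [lt_abs]; left; linarith [hx.1]

/-- Parseval's identity for the periodisation of a continuous even function of compact support. -/
theorem hasSum_sq_cosCoeff (hp : Continuous p) (he : ∀ x, p (-x) = p x)
    (hs : ∀ x, (N : ℝ) < |x| → p x = 0) :
    HasSum (fun n : ℤ => cosCoeff p n ^ 2) (∫ x in (0 : ℝ)..1, (∑' k : ℤ, p (x + k)) ^ 2) := by
  set S := Finset.Icc (-(N + 1) : ℤ) N with hS
  set F : ℝ → ℂ := fun x => ((∑ k ∈ S, p (x + k) : ℝ) : ℂ) with hF
  have hFc : Continuous F := by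
    simp only [hF]
    fun_prop
  have hpi := integrable_of_continuous_of_support hp hs
  have hL2 : MemLp F 2 (volume.restrict (Ioc 0 1)) := by
    obtain ⟨C, hC⟩ := (isCompact_Icc (a := (0 : ℝ)) (b := 1)).exists_bound_of_continuousOn
      hFc.continuousOn
    refine MemLp.of_bound hFc.aestronglyMeasurable C ?_
    refine (ae_restrict_iff' measurableSet_Ioc).2
      (ae_of_all _ fun x hx => hC x (Ioc_subset_Icc_self hx))
  have key := hasSum_sq_fourierCoeffOn (zero_lt_one' ℝ) hL2
  -- the integral over `ℝ` is folded into `[0, 1]`, where the exponential is `1`-periodic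
  have hcoef : ∀ m, fourierCoeffOn (zero_lt_one' ℝ) F m = cosCoeff p m := by
    intro m
    set e : ℝ → ℂ := fun x => Complex.exp (-(2 * Real.pi * Complex.I * m * x)) with he'
    have hper : ∀ (x : ℝ) (k : ℤ), e (x + k) = e x := by
      intro x k
      simp only [he']
      rw [show -(2 * (Real.pi : ℂ) * Complex.I * m * ((x + k : ℝ) : ℂ)) =
        -(2 * Real.pi * Complex.I * m * x) + ((-(m * k) : ℤ) : ℂ) * (2 * Real.pi * Complex.I) by
          push_cast; ring, Complex.exp_add, Complex.exp_int_mul_two_pi_mul_I, mul_one]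
    have hei : Integrable fun x => e x * (p x : ℂ) := by
      refine hpi.ofReal.bdd_mul (c := 1) (by fun_prop) (ae_of_all _ fun x => ?_)
      simp only [he']
      rw [show -(2 * (Real.pi : ℂ) * Complex.I * m * (x : ℂ)) =
        ((-(2 * Real.pi * m * x) : ℝ) : ℂ) * Complex.I by push_cast; ring,
        Complex.norm_exp_ofReal_mul_I]
    rw [fourierCoeffOn_eq_integral, ← integral_exp_mul_eq_cosCoeff hpi he,
      ← hei.hasSum_intervalIntegral_comp_add_int.tsum_eq, tsum_eq_sum (s := S),
      ← intervalIntegral.integral_finsetSum]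
    · simp only [sub_zero, div_one, one_smul]
      refine intervalIntegral.integral_congr fun x _ => ?_
      simp only [hF]
      have hf : (fourier (-m)) (x : AddCircle (1 - 0 : ℝ)) = e x := by
        rw [fourier_coe_apply]
        simp only [he']
        congr 1
        push_cast
        ring
      rw [hf, smul_eq_mul, Complex.ofReal_sum, Finset.mul_sum]
      exact Finset.sum_congr rfl fun k _ => by rw [hper]
    · intro k _
      refine Continuous.intervalIntegrable ?_ _ _
      simp only [he']
      fun_prop
    · intro k hk
      rw [intervalIntegral.integral_congr (g := fun _ => 0), intervalIntegral.integral_zero]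
      intro x hx
      rw [uIcc_of_le zero_le_one] at hx
      simp only
      have hk' : p (x + k) = 0 := by
        refine hs _ ?_
        rw [hS, Finset.mem_Icc, not_and_or, not_le, not_le] at hk
        rcases hk with hk | hk
        · have : (k : ℝ) + 1 ≤ -(N + 1) := by exact_mod_cast hk
          rw [lt_abs]; right; linarith [hx.2]
        · have : (N : ℝ) + 1 ≤ k := by exact_mod_cast hk
          rw [lt_abs]; left; linarith [hx.1]
      rw [hk', Complex.ofReal_zero, mul_zero]
  convert key using 1
  · funext n
    rw [hcoef, Complex.norm_real, Real.norm_eq_abs, sq_abs]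
  · simp only [sub_zero, inv_one, one_smul]
    refine intervalIntegral.integral_congr fun x hx => ?_
    rw [uIcc_of_le zero_le_one] at hx
    simp only [hF]
    rw [Complex.norm_real, Real.norm_eq_abs, sq_abs, tsum_comp_add_eq_sum hs hx]

lemma tsum_sq_cosCoeff_le (hp : Continuous p) (he : ∀ x, p (-x) = p x)
    (hs : ∀ x, (N : ℝ) < |x| → p x = 0) {ε : ℝ} (hε : ∀ x, |p x| ≤ ε) :
    ∑' n : ℤ, cosCoeff p n ^ 2 ≤ ((2 * N + 2) * ε) ^ 2 := by
  rw [(hasSum_sq_cosCoeff hp he hs).tsum_eq]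
  have hb : ∀ x ∈ Icc (0 : ℝ) 1, |∑' k : ℤ, p (x + k)| ≤ (2 * N + 2) * ε := by
    intro x hx
    rw [tsum_comp_add_eq_sum hs hx]
    refine (Finset.abs_sum_le_sum_abs _ _).trans ((Finset.sum_le_card_nsmul _ _ ε
      fun k _ => hε _).trans (le_of_eq ?_))
    rw [Int.card_Icc, nsmul_eq_mul]
    have : ((N : ℤ) + 1 - (-(N + 1))).toNat = 2 * N + 2 := by omega
    rw [this]
    push_cast
    ring
  have h := intervalIntegral.norm_integral_le_of_norm_le_const (a := (0 : ℝ)) (b := 1)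
    (f := fun x => (∑' k : ℤ, p (x + k)) ^ 2) (C := ((2 * N + 2) * ε) ^ 2) fun x hx => by
      rw [uIoc_of_le zero_le_one] at hx
      rw [Real.norm_eq_abs, abs_pow]
      exact pow_le_pow_left₀ (abs_nonneg _) (hb x (Ioc_subset_Icc_self hx)) 2
  rw [sub_zero, abs_one, mul_one] at h
  exact (le_abs_self _).trans h

lemma integral_cos_two_pi_int_mul (n : ℤ) :
    ∫ θ in (-(N : ℝ))..N, Real.cos (2 * Real.pi * n * θ) = if n = 0 then 2 * (N : ℝ) else 0 := by
  split_ifs with h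
  · simp [h]; ring
  · have hne : 2 * Real.pi * (n : ℝ) ≠ 0 := by
      have : (n : ℝ) ≠ 0 := by exact_mod_cast h
      positivity
    have h1 : Real.sin (2 * Real.pi * n * N) = 0 := by
      rw [show 2 * Real.pi * (n : ℝ) * N = ((2 * n * N : ℤ) : ℝ) * Real.pi by push_cast; ring]
      exact Real.sin_int_mul_pi _
    rw [intervalIntegral.integral_comp_mul_left (fun x => Real.cos x) hne, integral_cos]
    rw [h1, mul_neg, Real.sin_neg, h1]
    simp

/-- The Toeplitz form of a bounded symbol of compact support is bounded by a multiple of the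
identity. -/
theorem toeplitz_form_le (hp : Continuous p) (hs : ∀ x, (N : ℝ) < |x| → p x = 0) {C : ℝ}
    (hC : ∀ x, p x ≤ C) {M : ℕ} (x : Fin M → ℝ) :
    ∑ k, ∑ l, x k * x l * cosCoeff p ((k : ℤ) - (l : ℤ)) ≤ 2 * N * C * ∑ k, x k ^ 2 := by
  have hpi := integrable_of_continuous_of_support hp hs
  -- the form is the integral of `p` against the squared modulus of a trigonometric polynomial
  set T : ℝ → ℝ := fun θ => ∑ k, ∑ l, x k * x l *
    Real.cos (2 * Real.pi * (((k : ℤ) - (l : ℤ) : ℤ) : ℝ) * θ) with hT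
  have hTsq : ∀ θ, T θ = (∑ k : Fin M, x k * Real.cos (2 * Real.pi * k * θ)) ^ 2 +
      (∑ k : Fin M, x k * Real.sin (2 * Real.pi * k * θ)) ^ 2 := by
    intro θ
    simp only [hT, sq, Finset.sum_mul_sum]
    rw [← Finset.sum_add_distrib]
    refine Finset.sum_congr rfl fun k _ => ?_
    rw [← Finset.sum_add_distrib]
    refine Finset.sum_congr rfl fun l _ => ?_
    rw [show 2 * Real.pi * (((k : ℤ) - (l : ℤ) : ℤ) : ℝ) * θ =
      2 * Real.pi * k * θ - 2 * Real.pi * l * θ by push_cast; ring, Real.cos_sub]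
    ring
  have hT0 : ∀ θ, 0 ≤ T θ := fun θ => by rw [hTsq]; positivity
  have hTc : Continuous T := by
    simp only [hT]
    fun_prop
  have h1 : ∑ k, ∑ l, x k * x l * cosCoeff p ((k : ℤ) - (l : ℤ)) = ∫ θ, p θ * T θ := by
    have hterm : ∀ k l : Fin M, Integrable fun θ => p θ * (x k * x l *
        Real.cos (2 * Real.pi * (((k : ℤ) - (l : ℤ) : ℤ) : ℝ) * θ)) := fun k l =>
      ((integrable_mul_cos hpi ((k : ℤ) - (l : ℤ))).const_mul (x k * x l)).congr
        (ae_of_all _ fun θ => by simp only; ring)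
    simp only [cosCoeff, hT, Finset.mul_sum]
    rw [integral_finsetSum _ fun k _ => integrable_finsetSum _ fun l _ => hterm k l]
    refine Finset.sum_congr rfl fun k _ => ?_
    rw [integral_finsetSum _ fun l _ => hterm k l]
    refine Finset.sum_congr rfl fun l _ => ?_
    rw [← integral_const_mul]
    refine integral_congr_ae (ae_of_all _ fun θ => ?_)
    simp only
    ring
  have h2 : ∫ θ, p θ * T θ = ∫ θ in (-(N : ℝ))..N, p θ * T θ := by
    rw [intervalIntegral.integral_of_le (by linarith [(Nat.cast_nonneg N : (0 : ℝ) ≤ N)]),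
      ← integral_Icc_eq_integral_Ioc]
    refine (setIntegral_eq_integral_of_forall_compl_eq_zero fun θ hθ => ?_).symm
    rw [hs θ (not_le.1 fun h => hθ (abs_le.1 h)), zero_mul]
  have h3 : ∫ θ in (-(N : ℝ))..N, C * T θ = 2 * N * C * ∑ k, x k ^ 2 := by
    rw [intervalIntegral.integral_const_mul]
    simp only [hT]
    rw [intervalIntegral.integral_finsetSum fun k _ => Continuous.intervalIntegrable
      (by fun_prop) _ _]
    have : ∀ k : Fin M, ∫ θ in (-(N : ℝ))..N, ∑ l, x k * x l *
        Real.cos (2 * Real.pi * (((k : ℤ) - (l : ℤ) : ℤ) : ℝ) * θ) = 2 * N * x k ^ 2 := by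
      intro k
      rw [intervalIntegral.integral_finsetSum fun l _ => Continuous.intervalIntegrable
        (by fun_prop) _ _]
      simp_rw [intervalIntegral.integral_const_mul, integral_cos_two_pi_int_mul]
      have hkl : ∀ l : Fin M, ((k : ℤ) - (l : ℤ) = 0) ↔ k = l := fun l => by
        rw [sub_eq_zero, Nat.cast_inj, Fin.val_inj]
      simp only [hkl, mul_ite, mul_zero, Finset.sum_ite_eq, Finset.mem_univ, if_true]
      ring
    simp_rw [this]
    rw [← Finset.mul_sum]
    ring
  rw [h1, h2, ← h3]
  refine intervalIntegral.integral_mono_on (by linarith [(Nat.cast_nonneg N : (0 : ℝ) ≤ N)])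
    ((hp.mul hTc).intervalIntegrable _ _) ((continuous_const.mul hTc).intervalIntegrable _ _)
    fun θ _ => mul_le_mul_of_nonneg_right (hC θ) (hT0 θ)

end CosCoeff

/-! ### Averages over Toeplitz matrices -/

section Toeplitz

/-- The number of entries of an `M × M` matrix on the diagonal `k - l = n`. -/
def diagonalCount (M : ℕ) (n : ℤ) : ℕ :=
  (Finset.univ.filter fun p : Fin M × Fin M => (p.1 : ℤ) - (p.2 : ℤ) = n).card

lemma diagonalCount_le (M : ℕ) (n : ℤ) : diagonalCount M n ≤ M := by
  refine (Finset.card_le_card_of_injOn (t := (Finset.univ : Finset (Fin M))) Prod.fst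
    (fun _ _ => Finset.mem_coe.2 (Finset.mem_univ _)) ?_).trans (by simp)
  intro p hp q hq h
  simp only [Finset.coe_filter, Finset.mem_univ, true_and, mem_ofPred_eq] at hp hq
  refine Prod.ext h (Fin.ext ?_)
  rw [h] at hp
  omega

lemma le_diagonalCount (M : ℕ) (n : ℤ) : M - n.natAbs ≤ diagonalCount M n := by
  have hcard : M - n.natAbs = (Finset.univ : Finset (Fin (M - n.natAbs))).card := by simp
  rw [hcard]
  rcases le_total 0 n with hn | hn
  · refine Finset.card_le_card_of_injOn
      (fun i => (⟨i + n.natAbs, by omega⟩, ⟨i, by omega⟩)) (fun i _ => ?_) ?_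
    · simp [hn]
    · intro i _ j _ h
      simpa [Fin.ext_iff] using h
  · refine Finset.card_le_card_of_injOn
      (fun i => (⟨i, by omega⟩, ⟨i + n.natAbs, by omega⟩)) (fun i _ => ?_) ?_
    · simp only [Finset.coe_filter, Finset.mem_univ, true_and, mem_ofPred_eq]
      push_cast
      rw [abs_of_nonpos hn]
      ring
    · intro i _ j _ h
      simpa [Fin.ext_iff] using h

lemma sum_sum_sub_eq_tsum (M : ℕ) (F : ℤ → ℝ) :
    ∑ k : Fin M, ∑ l : Fin M, F ((k : ℤ) - (l : ℤ)) = ∑' n : ℤ, (diagonalCount M n : ℝ) * F n := by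
  have h1 : ∀ n : ℤ, (diagonalCount M n : ℝ) * F n =
      ∑ p : Fin M × Fin M, if n = (p.1 : ℤ) - (p.2 : ℤ) then F n else 0 := by
    intro n
    rw [← Finset.sum_filter, Finset.sum_const, nsmul_eq_mul, diagonalCount]
    simp_rw [eq_comm]
  simp_rw [h1]
  have hsm : ∀ p : Fin M × Fin M,
      Summable fun n : ℤ => if n = (p.1 : ℤ) - (p.2 : ℤ) then F n else 0 := fun p =>
    summable_of_ne_finset_zero (s := {(p.1 : ℤ) - (p.2 : ℤ)}) fun n hn =>
      if_neg (by simpa using hn)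
  rw [Summable.tsum_finsetSum fun p _ => hsm p, ← Finset.univ_product_univ,
    Finset.sum_product]
  refine Finset.sum_congr rfl fun k _ => Finset.sum_congr rfl fun l _ => ?_
  rw [tsum_eq_single ((k : ℤ) - (l : ℤ)) fun n hn => if_neg hn, if_pos rfl]

lemma tendsto_diagonalCount_div (n : ℤ) :
    Tendsto (fun M : ℕ => (diagonalCount M n : ℝ) / M) atTop (𝓝 1) := by
  have h1 : Tendsto (fun M : ℕ => 1 - (n.natAbs : ℝ) / M) atTop (𝓝 1) := by
    simpa using tendsto_const_nhds.sub (tendsto_const_div_atTop_nhds_zero_nat (n.natAbs : ℝ))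
  refine tendsto_of_tendsto_of_tendsto_of_le_of_le' h1 tendsto_const_nhds ?_ ?_
  · filter_upwards [eventually_gt_atTop 0] with M hM
    have hM' : (0 : ℝ) < M := by exact_mod_cast hM
    rw [← div_self hM'.ne', ← sub_div]
    gcongr
    have : M ≤ diagonalCount M n + n.natAbs := by have := le_diagonalCount M n; omega
    have : (M : ℝ) ≤ diagonalCount M n + n.natAbs := by exact_mod_cast this
    linarith
  · filter_upwards [eventually_gt_atTop 0] with M hM
    have hM' : (0 : ℝ) < M := by exact_mod_cast hM
    rw [div_le_one hM']
    exact_mod_cast diagonalCount_le M n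

lemma tendsto_toeplitz_average {F : ℤ → ℝ} (hF : Summable F) :
    Tendsto (fun M : ℕ => (M : ℝ)⁻¹ * ∑ k : Fin M, ∑ l : Fin M, F ((k : ℤ) - (l : ℤ))) atTop
      (𝓝 (∑' n, F n)) := by
  simp_rw [sum_sum_sub_eq_tsum, ← tsum_mul_left]
  refine tendsto_tsum_of_dominated_convergence hF.abs (fun n => ?_) ?_
  · have := (tendsto_diagonalCount_div n).mul_const (F n)
    rw [one_mul] at this
    exact this.congr fun M => by ring
  · filter_upwards [eventually_gt_atTop 0] with M hM n
    have hM' : (0 : ℝ) < M := by exact_mod_cast hM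
    rw [← mul_assoc, Real.norm_eq_abs, abs_mul]
    refine mul_le_of_le_one_left (abs_nonneg _) ?_
    rw [abs_of_nonneg (by positivity), inv_mul_le_iff₀ hM', mul_one]
    exact_mod_cast diagonalCount_le M n

lemma abs_toeplitz_average_le {F : ℤ → ℝ} (hF : Summable F) (M : ℕ) :
    |(M : ℝ)⁻¹ * ∑ k : Fin M, ∑ l : Fin M, F ((k : ℤ) - (l : ℤ))| ≤ ∑' n, |F n| := by
  rcases Nat.eq_zero_or_pos M with rfl | hM
  · simpa using tsum_nonneg fun n => abs_nonneg (F n)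
  have hM' : (0 : ℝ) < M := by exact_mod_cast hM
  rw [abs_mul, abs_of_pos (inv_pos.2 hM'), inv_mul_le_iff₀ hM']
  calc |∑ k : Fin M, ∑ l : Fin M, F ((k : ℤ) - (l : ℤ))|
      ≤ ∑ k : Fin M, ∑ l : Fin M, |F ((k : ℤ) - (l : ℤ))| :=
        (Finset.abs_sum_le_sum_abs _ _).trans
          (Finset.sum_le_sum fun k _ => Finset.abs_sum_le_sum_abs _ _)
    _ ≤ ∑ _k : Fin M, ∑' n, |F n| := by
        refine Finset.sum_le_sum fun k _ => ?_
        have hinj : Function.Injective fun l : Fin M => (k : ℤ) - (l : ℤ) := fun l l' h => by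
          simp only [sub_right_inj, Nat.cast_inj] at h
          exact Fin.ext h
        rw [← Finset.sum_image (f := fun n => |F n|) (g := fun l : Fin M => (k : ℤ) - (l : ℤ))
          fun l _ l' _ h => hinj h]
        exact hF.abs.sum_le_tsum _ fun n _ => abs_nonneg _
    _ = _ := by simp

/-- Averages of squared entries of Toeplitz matrices, for symbols whose coefficients converge in
`ℓ²`. -/
lemma tendsto_toeplitz_average_sq {r : ℕ → ℤ → ℝ} {ρ : ℤ → ℝ} (hρ : Summable fun n => ρ n ^ 2)
    (hd : ∀ᶠ j in atTop, Summable fun n => (r j n - ρ n) ^ 2)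
    (hlim : Tendsto (fun j => ∑' n, (r j n - ρ n) ^ 2) atTop (𝓝 0))
    {M : ℕ → ℕ} (hM : Tendsto M atTop atTop) :
    Tendsto (fun j => (M j : ℝ)⁻¹ * ∑ k : Fin (M j), ∑ l : Fin (M j),
      r j ((k : ℤ) - (l : ℤ)) ^ 2) atTop (𝓝 (∑' n, ρ n ^ 2)) := by
  have h1 := (tendsto_toeplitz_average hρ).comp hM
  suffices h : Tendsto (fun j => (M j : ℝ)⁻¹ * ∑ k : Fin (M j), ∑ l : Fin (M j),
      (r j ((k : ℤ) - (l : ℤ)) ^ 2 - ρ ((k : ℤ) - (l : ℤ)) ^ 2)) atTop (𝓝 0) by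
    have h2 := h.add h1
    rw [zero_add] at h2
    refine h2.congr fun j => ?_
    simp only [Function.comp_apply, Finset.sum_sub_distrib]
    ring
  set S := ∑' n, ρ n ^ 2 with hS
  have hS0 : 0 ≤ S := tsum_nonneg fun n => sq_nonneg _
  rw [Metric.tendsto_nhds]
  intro ε hε
  -- `|r² - ρ²| ≤ (1 + 1/κ)(r - ρ)² + κ ρ²`, with `κ` small compared with `1 / ∑ ρ²`
  set κ := ε / (2 * (S + 1)) with hκ
  have hκ0 : 0 < κ := by positivity
  have hsmall : ∀ᶠ j in atTop, ∑' n, (r j n - ρ n) ^ 2 < ε / (2 * (1 + 1 / κ)) :=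
    hlim.eventually_lt_const (by positivity)
  filter_upwards [hd, hsmall] with j hdj hj
  have hb : ∀ n, |r j n ^ 2 - ρ n ^ 2| ≤ (1 + 1 / κ) * (r j n - ρ n) ^ 2 + κ * ρ n ^ 2 := by
    intro n
    have e1 : r j n ^ 2 - ρ n ^ 2 = (r j n - ρ n) ^ 2 + 2 * (r j n - ρ n) * ρ n := by ring
    have e2 : |2 * (r j n - ρ n) * ρ n| ≤ 1 / κ * (r j n - ρ n) ^ 2 + κ * ρ n ^ 2 := by
      have h3 : ∀ s : ℝ, s ^ 2 = 1 → s * (2 * (r j n - ρ n) * ρ n) ≤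
          1 / κ * (r j n - ρ n) ^ 2 + κ * ρ n ^ 2 := by
        intro s hs
        have : 0 ≤ (1 / κ) * ((r j n - ρ n) - s * κ * ρ n) ^ 2 := by positivity
        have h4 : (1 / κ) * ((r j n - ρ n) - s * κ * ρ n) ^ 2 = 1 / κ * (r j n - ρ n) ^ 2 -
            s * (2 * (r j n - ρ n) * ρ n) + s ^ 2 * (κ * ρ n ^ 2) := by
          field_simp
          ring
        rw [h4, hs] at this
        linarith
      rw [abs_le]
      constructor
      · linarith [h3 (-1) (by norm_num)]
      · linarith [h3 1 (by norm_num)]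
    rw [e1]
    refine (abs_add_le _ _).trans ?_
    rw [abs_of_nonneg (sq_nonneg _)]
    linarith
  have hsum1 := hdj.mul_left (1 + 1 / κ)
  have hsum2 := hρ.mul_left κ
  have habs : Summable fun n => |r j n ^ 2 - ρ n ^ 2| :=
    Summable.of_nonneg_of_le (fun _ => abs_nonneg _) hb (hsum1.add hsum2)
  rw [dist_zero_right, Real.norm_eq_abs]
  calc _ ≤ ∑' n, |r j n ^ 2 - ρ n ^ 2| :=
        abs_toeplitz_average_le (F := fun n => r j n ^ 2 - ρ n ^ 2) habs.of_abs _
    _ ≤ ∑' n, ((1 + 1 / κ) * (r j n - ρ n) ^ 2 + κ * ρ n ^ 2) :=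
        habs.tsum_le_tsum hb (hsum1.add hsum2)
    _ = (1 + 1 / κ) * ∑' n, (r j n - ρ n) ^ 2 + κ * S := by
        rw [hsum1.tsum_add hsum2, tsum_mul_left, tsum_mul_left]
    _ < (1 + 1 / κ) * (ε / (2 * (1 + 1 / κ))) + κ * (S + 1) := by
        refine add_lt_add ?_ ?_
        · exact mul_lt_mul_of_pos_left hj (by positivity)
        · exact mul_lt_mul_of_pos_left (by linarith) hκ0
    _ = ε := by
        rw [hκ]
        field_simp
        ring

/-- For continuous even symbols with common compact support that converge uniformly, the averages
of squared Fourier coefficients over growing Toeplitz matrices converge to the squared `L²` norm of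
the periodised limit symbol. -/
theorem tendsto_toeplitz_average_sq_cosCoeff {p : ℕ → ℝ → ℝ} {q : ℝ → ℝ} {N : ℕ}
    (hp : ∀ᶠ j in atTop, Continuous (p j) ∧ (∀ x, p j (-x) = p j x) ∧
      ∀ x, (N : ℝ) < |x| → p j x = 0)
    (hq : Continuous q) (hqe : ∀ x, q (-x) = q x) (hqs : ∀ x, (N : ℝ) < |x| → q x = 0)
    (hlim : ∀ ε > 0, ∀ᶠ j in atTop, ∀ x, |p j x - q x| ≤ ε)
    {M : ℕ → ℕ} (hM : Tendsto M atTop atTop) :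
    Tendsto (fun j => (M j : ℝ)⁻¹ * ∑ k : Fin (M j), ∑ l : Fin (M j),
      cosCoeff (p j) ((k : ℤ) - (l : ℤ)) ^ 2) atTop
      (𝓝 (∫ x in (0 : ℝ)..1, (∑' k : ℤ, q (x + k)) ^ 2)) := by
  have hρ := hasSum_sq_cosCoeff hq hqe hqs
  rw [← hρ.tsum_eq]
  have hdiff : ∀ᶠ j in atTop, (∀ n, cosCoeff (p j) n - cosCoeff q n =
      cosCoeff (fun x => p j x - q x) n) ∧ Continuous (fun x => p j x - q x) ∧
      (∀ x, p j (-x) - q (-x) = p j x - q x) ∧ ∀ x, (N : ℝ) < |x| → p j x - q x = 0 := by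
    filter_upwards [hp] with j ⟨h1, h2, h3⟩
    refine ⟨fun n => (cosCoeff_sub (integrable_of_continuous_of_support h1 h3)
      (integrable_of_continuous_of_support hq hqs) n).symm, h1.sub hq, fun x => ?_,
      fun x hx => ?_⟩
    · rw [h2, hqe]
    · rw [h3 x hx, hqs x hx, sub_zero]
  refine tendsto_toeplitz_average_sq hρ.summable ?_ ?_ hM
  · filter_upwards [hdiff] with j ⟨h1, h2, h3, h4⟩
    simp_rw [h1]
    exact (hasSum_sq_cosCoeff h2 h3 h4).summable
  · rw [Metric.tendsto_nhds]
    intro ε hε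
    set δ := √(ε / 2) / (2 * N + 2) with hδ
    have hδ0 : 0 < δ := by positivity
    filter_upwards [hdiff, hlim δ hδ0] with j ⟨h1, h2, h3, h4⟩ hj
    simp_rw [h1]
    have hle := tsum_sq_cosCoeff_le h2 h3 h4 hj
    have : ((2 * (N : ℝ) + 2) * δ) ^ 2 = ε / 2 := by
      rw [hδ, mul_div_cancel₀ _ (by positivity), Real.sq_sqrt (by positivity)]
    rw [this] at hle
    rw [dist_zero_right, Real.norm_of_nonneg (tsum_nonneg fun _ => sq_nonneg _)]
    linarith

end Toeplitz

/-! ### The spectral density near the origin -/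

section Density

variable {s₀ α : ℝ} {h : ℝ → ℝ}

lemma cyclicDensity_eq {u : ℝ} (hu : |u| < s₀) :
    cyclicDensity s₀ α h u = h u * (s₀ ^ 2 - u ^ 2) ^ (-(2 * α)) := by
  have h1 : u ^ 2 < s₀ ^ 2 := by
    rw [← sq_abs u]
    gcongr
  rw [cyclicDensity, abs_of_neg (by linarith), neg_sub, Real.rpow_neg (by linarith), div_eq_mul_inv]

lemma cyclicDensity_neg (he : ∀ x, h (-x) = h x) (u : ℝ) :
    cyclicDensity s₀ α h (-u) = cyclicDensity s₀ α h u := by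
  simp only [cyclicDensity, he, neg_sq]

lemma continuousAt_cyclicDensity (hc : Continuous h) {u : ℝ} (hu : |u| < s₀) :
    ContinuousAt (cyclicDensity s₀ α h) u := by
  have h1 : u ^ 2 < s₀ ^ 2 := by
    rw [← sq_abs u]
    gcongr
  have h2 : ContinuousAt (fun u => h u * (s₀ ^ 2 - u ^ 2) ^ (-(2 * α))) u :=
    hc.continuousAt.mul (ContinuousAt.rpow_const (by fun_prop) (Or.inl (by linarith)))
  refine h2.congr ?_
  have : ∀ᶠ x in 𝓝 u, |x| < s₀ := continuous_abs.continuousAt.eventually_lt_const hu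
  filter_upwards [this] with x hx
  rw [cyclicDensity_eq hx]

/-- An even function of class `C⁴` whose derivatives of orders one to four vanish at the origin is
constant there up to the fourth order. Evenness transfers Taylor's formula from `[0, 1]` to
`[-1, 1]`. -/
lemma exists_abs_sub_le_pow_four (hd : ContDiff ℝ 4 h) (he : ∀ x, h (-x) = h x)
    (h0 : ∀ i ∈ Finset.Icc 1 4, iteratedDeriv i h 0 = 0) :
    ∃ C, 0 ≤ C ∧ ∀ u : ℝ, |u| ≤ 1 → |h u - h 0| ≤ C * u ^ 4 := by
  obtain ⟨C, hC⟩ := exists_taylor_mean_remainder_bound (f := h) (a := 0) (b := 1) (n := 3)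
    zero_le_one (by norm_num; exact hd.contDiffOn)
  have hT : ∀ x, taylorWithinEval h 3 (Icc 0 1) 0 x = h 0 := by
    intro x
    have hz : ∀ i ∈ Finset.Icc 1 4, iteratedDerivWithin i h (Icc 0 1) 0 = 0 := by
      intro i hi
      rw [iteratedDerivWithin_eq_iteratedDeriv (uniqueDiffOn_Icc zero_lt_one) _ (by simp), h0 i hi]
      refine hd.contDiffAt.of_le ?_
      exact_mod_cast (Finset.mem_Icc.1 hi).2
    rw [taylorWithinEval_succ, taylorWithinEval_succ, taylorWithinEval_succ,
      taylor_within_zero_eval]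
    norm_num [hz 1 (by simp), hz 2 (by simp), hz 3 (by simp)]
  refine ⟨|C|, abs_nonneg _, fun u hu => ?_⟩
  have key : |h |u| - h 0| ≤ |C| * u ^ 4 := by
    have := hC |u| ⟨abs_nonneg _, hu⟩
    rw [hT, sub_zero, Real.norm_eq_abs] at this
    norm_num at this
    have h4 : |u| ^ 4 = u ^ 4 := by rw [pow_abs, abs_of_nonneg (by positivity)]
    rw [h4] at this
    exact this.trans (mul_le_mul_of_nonneg_right (le_abs_self C) (by positivity))
  rcases abs_choice u with hu' | hu' <;> rw [hu'] at key
  · exact key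
  · rwa [he] at key

lemma exists_abs_rpow_sub_le (hs : 0 < s₀) :
    ∃ C, 0 ≤ C ∧ ∀ y ∈ Icc (0 : ℝ) (s₀ ^ 2 / 2),
      |(s₀ ^ 2 - y) ^ (-(2 * α)) - (s₀ ^ (-4 * α) + 2 * α * s₀ ^ (-4 * α - 2) * y)| ≤
        C * y ^ 2 := by
  set φ : ℝ → ℝ := fun y => (s₀ ^ 2 - y) ^ (-(2 * α)) with hφ
  have hs2 : 0 < s₀ ^ 2 := by positivity
  have hcd : ∀ y, y < s₀ ^ 2 → ContDiffAt ℝ 2 φ y := by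
    intro y hy
    exact ContDiffAt.rpow_const_of_ne (by fun_prop) (by linarith)
  have hcdo : ContDiffOn ℝ 2 φ (Icc 0 (s₀ ^ 2 / 2)) := fun y hy =>
    (hcd y (by linarith [hy.2])).contDiffWithinAt
  obtain ⟨C, hC⟩ := exists_taylor_mean_remainder_bound (f := φ) (a := 0) (b := s₀ ^ 2 / 2)
    (n := 1) (by positivity) (by norm_num; exact hcdo)
  have hd : deriv φ 0 = 2 * α * s₀ ^ (-4 * α - 2) := by
    have h1 : HasDerivAt (fun y : ℝ => s₀ ^ 2 - y) (-1) 0 := by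
      simpa using (hasDerivAt_id (0 : ℝ)).const_sub (s₀ ^ 2)
    have h2 := h1.rpow_const (p := -(2 * α)) (Or.inl (by simp [hs.ne']))
    rw [show deriv φ 0 = _ from h2.deriv, sub_zero, ← Real.rpow_natCast s₀ 2, ← Real.rpow_mul hs.le]
    rw [show ((2 : ℕ) : ℝ) * (-(2 * α) - 1) = -4 * α - 2 by push_cast; ring]
    ring
  have h0 : φ 0 = s₀ ^ (-4 * α) := by
    simp only [hφ, sub_zero]
    rw [← Real.rpow_natCast s₀ 2, ← Real.rpow_mul hs.le]
    congr 1
    push_cast; ring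
  have hT : ∀ y, taylorWithinEval φ 1 (Icc 0 (s₀ ^ 2 / 2)) 0 y =
      s₀ ^ (-4 * α) + 2 * α * s₀ ^ (-4 * α - 2) * y := by
    intro y
    rw [taylorWithinEval_succ, taylor_within_zero_eval, iteratedDerivWithin_eq_iteratedDeriv
      (uniqueDiffOn_Icc (by positivity)) ((hcd 0 hs2).of_le (by norm_num))
      (left_mem_Icc.2 (by positivity)), h0]
    norm_num [iteratedDeriv_one, hd]
    ring
  refine ⟨|C|, abs_nonneg _, fun y hy => ?_⟩
  have := hC y hy
  rw [hT, sub_zero, Real.norm_eq_abs] at this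
  exact this.trans (mul_le_mul_of_nonneg_right (le_abs_self C) (sq_nonneg y))

lemma cyclicDensity_zero (hs : 0 < s₀) (h1 : h 0 = 1) : cyclicDensity s₀ α h 0 = s₀ ^ (-4 * α) := by
  rw [cyclicDensity_eq (by simpa using hs), h1, one_mul, zero_pow two_ne_zero, sub_zero,
    ← Real.rpow_natCast s₀ 2, ← Real.rpow_mul hs.le]
  congr 1
  push_cast; ring

/-- The expansion of the spectral density at the origin up to the fourth order. -/
theorem exists_abs_cyclicDensity_sub_le (hm : IsCyclicModel s₀ α h) :
    ∃ C, 0 ≤ C ∧ ∀ u : ℝ, |u| ≤ 1 / 2 →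
      |cyclicDensity s₀ α h u - (s₀ ^ (-4 * α) + 2 * α * s₀ ^ (-4 * α - 2) * u ^ 2)| ≤
        C * u ^ 4 := by
  have hs1 := hm.one_lt
  have hs : 0 < s₀ := by linarith
  obtain ⟨C₁, hC₁, hh⟩ := exists_abs_sub_le_pow_four hm.contDiff hm.even hm.iteratedDeriv_zero
  obtain ⟨C₂, hC₂, hφ⟩ := exists_abs_rpow_sub_le (α := α) hs
  rw [hm.at_zero] at hh
  set L := s₀ ^ (-4 * α) + |2 * α * s₀ ^ (-4 * α - 2)| + C₂ with hL
  refine ⟨C₁ * L + C₂, ?_, fun u hu => ?_⟩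
  · have := Real.rpow_nonneg hs.le (-4 * α)
    positivity
  have hu2 : u ^ 2 ≤ 1 / 4 := by
    rw [← sq_abs]
    nlinarith [abs_nonneg u]
  rw [cyclicDensity_eq (by linarith)]
  have h1 := hh u (by linarith)
  have h2 := hφ (u ^ 2) ⟨sq_nonneg u, by nlinarith⟩
  set g := (s₀ ^ 2 - u ^ 2) ^ (-(2 * α)) with hg
  have hgL : |g| ≤ L := by
    have e1 : |g| ≤ |g - (s₀ ^ (-4 * α) + 2 * α * s₀ ^ (-4 * α - 2) * u ^ 2)| +
        (|s₀ ^ (-4 * α)| + |2 * α * s₀ ^ (-4 * α - 2) * u ^ 2|) := by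
      calc |g| = |(g - (s₀ ^ (-4 * α) + 2 * α * s₀ ^ (-4 * α - 2) * u ^ 2)) +
          (s₀ ^ (-4 * α) + 2 * α * s₀ ^ (-4 * α - 2) * u ^ 2)| := by congr 1; ring
        _ ≤ _ := (abs_add_le _ _).trans (add_le_add_right (abs_add_le _ _) _)
    have e2 : |s₀ ^ (-4 * α)| = s₀ ^ (-4 * α) := abs_of_nonneg (Real.rpow_nonneg hs.le _)
    have e3 : |2 * α * s₀ ^ (-4 * α - 2) * u ^ 2| ≤ |2 * α * s₀ ^ (-4 * α - 2)| := by
      rw [abs_mul, abs_of_nonneg (sq_nonneg u)]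
      exact mul_le_of_le_one_right (abs_nonneg _) (by linarith)
    have e4 : C₂ * (u ^ 2) ^ 2 ≤ C₂ := mul_le_of_le_one_right hC₂ (by nlinarith [sq_nonneg u])
    rw [hL]
    linarith
  calc |h u * g - (s₀ ^ (-4 * α) + 2 * α * s₀ ^ (-4 * α - 2) * u ^ 2)|
      = |(h u - 1) * g + (g - (s₀ ^ (-4 * α) + 2 * α * s₀ ^ (-4 * α - 2) * u ^ 2))| := by
        congr 1; ring
    _ ≤ |h u - 1| * |g| + |g - (s₀ ^ (-4 * α) + 2 * α * s₀ ^ (-4 * α - 2) * u ^ 2)| := by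
        refine (abs_add_le _ _).trans ?_
        rw [abs_mul]
    _ ≤ C₁ * u ^ 4 * L + C₂ * (u ^ 2) ^ 2 := by gcongr
    _ = _ := by ring

end Density

/-! ### Symbols of the filter transforms -/

section Symbol

/-- The function whose periodisation is the symbol of the Toeplitz covariance matrix of one level
of filter coefficients: `T f(Tθ/a) Φ(Tθ)`, where `f` is the spectral density, `Φ = |ψ̂|²`, `a` the
scale and `T = 2πa/γ`. -/
noncomputable def scaledSymbol (f Φ : ℝ → ℝ) (a T θ : ℝ) : ℝ := T * (f (T * θ / a) * Φ (T * θ))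

variable {f Φ : ℝ → ℝ} {A : ℝ}

lemma scaledSymbol_neg (hf : ∀ x, f (-x) = f x) (hΦ : ∀ x, Φ (-x) = Φ x) (a T θ : ℝ) :
    scaledSymbol f Φ a T (-θ) = scaledSymbol f Φ a T θ := by
  simp only [scaledSymbol, mul_neg, neg_div, hf, hΦ]

lemma continuous_mul_of_support {s a : ℝ} (ha : 0 < a) (hA : A < a * s)
    (hf : ∀ u, |u| < s → ContinuousAt f u) (hΦ : Continuous Φ) (hΦs : ∀ x, A < |x| → Φ x = 0) :
    Continuous fun η => f (η / a) * Φ η := by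
  refine continuous_iff_continuousAt.2 fun η => ?_
  rcases lt_or_ge A |η| with h | h
  · have : ∀ᶠ x in 𝓝 η, A < |x| := continuous_abs.continuousAt.eventually_const_lt h
    refine (continuousAt_const (y := (0 : ℝ))).congr ?_
    filter_upwards [this] with x hx
    rw [hΦs x hx, mul_zero]
  · refine ContinuousAt.mul ?_ hΦ.continuousAt
    have h1 : ContinuousAt f (η / a) := hf _ (by
      rw [abs_div, abs_of_pos ha, div_lt_iff₀ ha]
      linarith [mul_comm a s])
    exact ContinuousAt.comp (f := fun η : ℝ => η / a) h1 (by fun_prop)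

lemma continuous_scaledSymbol {s a : ℝ} (T : ℝ) (ha : 0 < a) (hA : A < a * s)
    (hf : ∀ u, |u| < s → ContinuousAt f u) (hΦ : Continuous Φ) (hΦs : ∀ x, A < |x| → Φ x = 0) :
    Continuous (scaledSymbol f Φ a T) :=
  continuous_const.mul ((continuous_mul_of_support ha hA hf hΦ hΦs).comp (continuous_const_mul T))

/-- If `a_j → ∞` and `T_j → T`, the symbols converge uniformly to `T f(0) Φ(Tθ)`. -/
lemma eventually_abs_scaledSymbol_sub_le (hf : ContinuousAt f 0) (hΦ : Continuous Φ)
    (hΦs : ∀ x, A < |x| → Φ x = 0) {a T : ℕ → ℝ} {T₀ : ℝ} (hT₀ : 0 < T₀)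
    (ha : Tendsto a atTop atTop) (hT : Tendsto T atTop (𝓝 T₀)) {ε : ℝ} (hε : 0 < ε) :
    ∀ᶠ j in atTop, ∀ θ, |scaledSymbol f Φ (a j) (T j) θ - T₀ * (f 0 * Φ (T₀ * θ))| ≤ ε := by
  have hcs : HasCompactSupport Φ := HasCompactSupport.intro (isCompact_Icc (a := -A) (b := A))
    fun x hx => hΦs x (not_le.1 fun h => hx (abs_le.1 h))
  obtain ⟨B₀, hB₀⟩ := hcs.exists_bound_of_continuous hΦ
  set B := |B₀| + 1 with hB
  have hBpos : 0 < B := by positivity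
  have hΦB : ∀ x, |Φ x| ≤ B := fun x => (hB₀ x).trans (by rw [hB]; linarith [le_abs_self B₀])
  have huc := hΦ.uniformContinuous_of_tendsto_cocompact (x := 0)
    (hcs.is_zero_at_infty)
  -- three error terms: `f(Tθ/a) - f(0)`, `T - T₀` and `Φ(Tθ) - Φ(T₀θ)`
  set ε₁ := ε / (3 * (2 * T₀ * B)) with hε₁
  have hε₁0 : 0 < ε₁ := by positivity
  set ε₃ := ε / (3 * (T₀ * (|f 0| + 1))) with hε₃
  have hε₃0 : 0 < ε₃ := by positivity
  obtain ⟨δ₁, hδ₁, hfδ⟩ := Metric.continuousAt_iff.1 hf ε₁ hε₁0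
  obtain ⟨δ₃, hδ₃, hΦδ⟩ := Metric.uniformContinuous_iff.1 huc ε₃ hε₃0
  have e1 : ∀ᶠ j in atTop, (|A| + 1) / δ₁ < a j := ha.eventually_gt_atTop _
  have e2 : ∀ᶠ j in atTop, T₀ / 2 < T j := hT.eventually_const_lt (by linarith)
  have e3 : ∀ᶠ j in atTop, T j < 2 * T₀ := hT.eventually_lt_const (by linarith)
  have e4 : ∀ᶠ j in atTop, |T j - T₀| < ε / (3 * (|f 0| + 1) * B) := by
    have := Metric.tendsto_nhds.1 hT (ε / (3 * (|f 0| + 1) * B)) (by positivity)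
    simpa only [Real.dist_eq] using this
  have e5 : ∀ᶠ j in atTop, |T j - T₀| < δ₃ / (2 * (|A| + 1) / T₀) := by
    have := Metric.tendsto_nhds.1 hT (δ₃ / (2 * (|A| + 1) / T₀)) (by positivity)
    simpa only [Real.dist_eq] using this
  filter_upwards [e1, e2, e3, e4, e5] with j h1 h2 h3 h4 h5 θ
  have hTpos : 0 < T j := by linarith
  have hapos : 0 < a j := lt_trans (by positivity) h1
  have hsplit : scaledSymbol f Φ (a j) (T j) θ - T₀ * (f 0 * Φ (T₀ * θ)) =
      T j * ((f (T j * θ / a j) - f 0) * Φ (T j * θ)) + (T j - T₀) * (f 0 * Φ (T j * θ)) +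
        T₀ * (f 0 * (Φ (T j * θ) - Φ (T₀ * θ))) := by
    simp only [scaledSymbol]; ring
  have t1 : |T j * ((f (T j * θ / a j) - f 0) * Φ (T j * θ))| ≤ ε / 3 := by
    rcases lt_or_ge A |T j * θ| with hh | hh
    · rw [hΦs _ hh]; simp; positivity
    · have hfd : |f (T j * θ / a j) - f 0| ≤ ε₁ := by
        refine (hfδ ?_).le
        rw [Real.dist_eq, sub_zero, abs_div, abs_of_pos hapos, div_lt_iff₀ hapos]
        rw [div_lt_iff₀ hδ₁] at h1
        linarith [le_abs_self A, mul_comm (a j) δ₁]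
      rw [abs_mul, abs_mul, abs_of_pos hTpos]
      calc T j * (|f (T j * θ / a j) - f 0| * |Φ (T j * θ)|) ≤ (2 * T₀) * (ε₁ * B) := by
            gcongr
            exact hΦB _
        _ = ε / 3 := by rw [hε₁]; field_simp
  have t2 : |(T j - T₀) * (f 0 * Φ (T j * θ))| ≤ ε / 3 := by
    rw [abs_mul, abs_mul]
    calc |T j - T₀| * (|f 0| * |Φ (T j * θ)|)
        ≤ ε / (3 * (|f 0| + 1) * B) * ((|f 0| + 1) * B) := by
          gcongr
          · linarith
          · exact hΦB _
      _ = ε / 3 := by field_simp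
  have t3 : |T₀ * (f 0 * (Φ (T j * θ) - Φ (T₀ * θ)))| ≤ ε / 3 := by
    have hd : |Φ (T j * θ) - Φ (T₀ * θ)| ≤ ε₃ := by
      rcases lt_or_ge (2 * (|A| + 1) / T₀) |θ| with hh | hh
      · rw [div_lt_iff₀ hT₀] at hh
        have k0 : 0 ≤ |θ| := abs_nonneg θ
        have k1 : A < |T j * θ| := by
          rw [abs_mul, abs_of_pos hTpos]
          nlinarith [le_abs_self A]
        have k2 : A < |T₀ * θ| := by
          rw [abs_mul, abs_of_pos hT₀]
          nlinarith [le_abs_self A, abs_nonneg A]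
        rw [hΦs _ k1, hΦs _ k2, sub_zero, abs_zero]
        exact hε₃0.le
      · refine (hΦδ ?_).le
        rw [Real.dist_eq, ← sub_mul, abs_mul]
        rw [lt_div_iff₀ (by positivity)] at h5
        exact lt_of_le_of_lt (mul_le_mul_of_nonneg_left hh (abs_nonneg _)) h5
    rw [abs_mul, abs_mul, abs_of_pos hT₀]
    calc T₀ * (|f 0| * |Φ (T j * θ) - Φ (T₀ * θ)|) ≤ T₀ * ((|f 0| + 1) * ε₃) := by
          gcongr
          linarith
      _ = ε / 3 := by rw [hε₃]; field_simp
  rw [hsplit]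
  refine (abs_add_le _ _).trans ?_
  have := abs_add_le (T j * ((f (T j * θ / a j) - f 0) * Φ (T j * θ)))
    ((T j - T₀) * (f 0 * Φ (T j * θ)))
  linarith

lemma scaledSymbol_eq_zero_of_support (hΦs : ∀ x, A < |x| → Φ x = 0) {a T θ : ℝ} (hT : 0 < T)
    {N : ℝ} (hN : A / T ≤ N) (hθ : N < |θ|) : scaledSymbol f Φ a T θ = 0 := by
  rw [scaledSymbol, hΦs, mul_zero, mul_zero]
  rw [abs_mul, abs_of_pos hT]
  rw [div_le_iff₀ hT] at hN
  nlinarith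

end Symbol

/-! ### Covariances of the filter transforms -/

section FilterCovariance

/-- The weight `t ↦ a^{-1/2} ψ((t - b)/a)`. -/
noncomputable def dilatedFilter (ψ : ℝ → ℝ) (a b t : ℝ) : ℝ := (1 / √a) * ψ ((t - b) / a)

variable {ψ : ℝ → ℝ} {a b : ℝ}

lemma integrable_dilatedFilter (hψ : Integrable ψ) (ha : 0 < a) :
    Integrable (dilatedFilter ψ a b) :=
  ((hψ.comp_div ha.ne').comp_sub_right b).const_mul _

lemma fourierHat_dilatedFilter (ha : 0 < a) (u : ℝ) :
    fourierHat (dilatedFilter ψ a b) u =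
      √a * (Complex.exp (-(Complex.I * u * b)) * fourierHat ψ (a * u)) := by
  have h1 := integral_sub_right_eq_self (μ := volume)
    (fun t : ℝ => Complex.exp (-(Complex.I * u * ((t + b : ℝ) : ℂ)))
      * (((1 / √a) * ψ (t / a) : ℝ) : ℂ)) b
  have h2 := Measure.integral_comp_div
    (fun t : ℝ => Complex.exp (-(Complex.I * u * ((a * t + b : ℝ) : ℂ)))
      * (((1 / √a) * ψ t : ℝ) : ℂ)) a
  simp only [sub_add_cancel] at h1
  simp only [mul_div_cancel₀ _ ha.ne'] at h2
  have hs : (√a : ℂ) * √a = a := by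
    rw [← Complex.ofReal_mul, Real.mul_self_sqrt ha.le]
  have hs0 : (√a : ℂ) ≠ 0 := by
    exact_mod_cast (Real.sqrt_pos.2 ha).ne'
  rw [fourierHat]
  simp only [dilatedFilter]
  rw [h1, h2, abs_of_pos ha, fourierHat, ← integral_const_mul, ← integral_const_mul,
    ← integral_smul]
  refine integral_congr_ae (ae_of_all _ fun t => ?_)
  simp only [Complex.real_smul]
  push_cast
  rw [show -(Complex.I * (u : ℂ) * (a * t + b)) =
    -(Complex.I * u * b) + -(Complex.I * (a * u) * t) by
    ring, Complex.exp_add]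
  rw [← hs]
  field_simp

lemma fourierHat_neg (ψ : ℝ → ℝ) (x : ℝ) :
    fourierHat ψ (-x) = (starRingEnd ℂ) (fourierHat ψ x) := by
  rw [← integral_mul_exp_eq_conj_fourierHat, fourierHat]
  refine integral_congr_ae (ae_of_all _ fun t => ?_)
  simp only
  rw [mul_comm]
  congr 2
  push_cast
  ring

variable {Ω : Type*} [MeasurableSpace Ω] {P : Measure Ω} {X : ℝ → Ω → ℝ} {f : ℝ → ℝ}

lemma IsStationaryGaussian.memLp_two (hX : IsStationaryGaussian P X) (t : ℝ) :
    MemLp (X t) 2 P :=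
  (hX.gaussian.hasGaussianLaw_eval t).memLp_two

lemma IsStationaryGaussian.integral_mul_eq [IsProbabilityMeasure P]
    (hX : IsStationaryGaussian P X) (hf : HasSpectralDensity P X f) (t s : ℝ) :
    ((∫ ω, X t ω * X s ω ∂P : ℝ) : ℂ) =
      ∫ u : ℝ, Complex.exp (Complex.I * u * ((t - s : ℝ) : ℂ)) * (f u : ℂ) := by
  rw [← hf.covariance_eq, covariance_eq_sub (hX.memLp_two t) (hX.memLp_two s), hX.centred t,
    zero_mul, sub_zero]
  rfl

lemma IsStationaryGaussian.integral_sq_le [IsProbabilityMeasure P]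
    (hX : IsStationaryGaussian P X) (hf : HasSpectralDensity P X f) (t : ℝ) :
    ∫ ω, X t ω ^ 2 ∂P ≤ ∫ u, f u := by
  have h := hX.integral_mul_eq hf t t
  simp only [sub_self, Complex.ofReal_zero, mul_zero, Complex.exp_zero, one_mul,
    integral_complex_ofReal] at h
  simp_rw [sq]
  exact (Complex.ofReal_injective h).le

/-- The covariance of two pathwise integrals in terms of the Fourier transforms of the weights. -/
lemma integral_processIntegral_mul_eq_spectral [IsProbabilityMeasure P]
    (hX : IsStationaryGaussian P X) (hf : HasSpectralDensity P X f) {φ χ : ℝ → ℝ}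
    (hφ : Integrable φ) (hχ : Integrable χ) :
    ((∫ ω, processIntegral X φ ω * processIntegral X χ ω ∂P : ℝ) : ℂ) =
      ∫ u : ℝ, (f u : ℂ) * ((starRingEnd ℂ) (fourierHat φ u) * fourierHat χ u) := by
  rw [integral_processIntegral_mul_processIntegral hX.measurable_uncurry hX.memLp_two
    (hX.integral_sq_le hf) hφ hχ, ← integral_integral_spectral hf.integrable hφ hχ,
    ← integral_complex_ofReal]
  refine integral_congr_ae (ae_of_all _ fun t => ?_)
  simp only
  rw [Complex.ofReal_mul, ← integral_complex_ofReal]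
  congr 1
  refine integral_congr_ae (ae_of_all _ fun s => ?_)
  simp only
  rw [Complex.ofReal_mul, hX.integral_mul_eq hf]

lemma cosCoeff_neg (p : ℝ → ℝ) (n : ℤ) : cosCoeff p (-n) = cosCoeff p n := by
  simp only [cosCoeff]
  refine integral_congr_ae (ae_of_all _ fun θ => ?_)
  simp only
  rw [show 2 * Real.pi * ((-n : ℤ) : ℝ) * θ = -(2 * Real.pi * n * θ) by push_cast; ring,
    Real.cos_neg]

/-- Within one level the covariances of the filter transforms are Fourier coefficients of the
periodised scaled symbol. -/
lemma integral_filter_mul_filter_same [IsProbabilityMeasure P]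
    (hX : IsStationaryGaussian P X) (hf : HasSpectralDensity P X f) (hfe : ∀ x, f (-x) = f x)
    (hψ : Integrable ψ) (ha : 0 < a) {γ : ℝ} (hγ : 0 < γ) {b' : ℝ} {n : ℤ}
    (hb : b - b' = γ * n) :
    ∫ ω, processIntegral X (dilatedFilter ψ a b) ω * processIntegral X (dilatedFilter ψ a b') ω ∂P =
      cosCoeff (scaledSymbol f (fun x => ‖fourierHat ψ x‖ ^ 2) a (2 * Real.pi * a / γ)) n := by
  set T := 2 * Real.pi * a / γ with hT
  have hTpos : 0 < T := by positivity
  have hTa : 0 < T / a := by positivity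
  set p := scaledSymbol f (fun x => ‖fourierHat ψ x‖ ^ 2) a T with hp
  have hpe : ∀ x, p (-x) = p x :=
    scaledSymbol_neg hfe (fun x => by rw [fourierHat_neg, RCLike.norm_conj]) a T
  have hpi : Integrable p := by
    have h1 : Integrable fun θ => f (T * θ / a) := by
      have := hf.integrable.comp_mul_left' hTa.ne'
      refine this.congr (ae_of_all _ fun θ => ?_)
      simp only
      congr 1
      ring
    refine (h1.mul_bdd (c := (∫ t, |ψ t|) ^ 2) ?_ (ae_of_all _ fun θ => ?_)).const_mul T
    · exact (((continuous_fourierHat hψ).comp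
        (continuous_const_mul T)).norm.pow 2).aestronglyMeasurable
    · rw [Real.norm_of_nonneg (by positivity)]
      exact pow_le_pow_left₀ (norm_nonneg _) (norm_fourierHat_le ψ _) 2
  rw [← cosCoeff_neg]
  refine Complex.ofReal_injective ?_
  rw [integral_processIntegral_mul_eq_spectral hX hf (integrable_dilatedFilter hψ ha)
    (integrable_dilatedFilter hψ ha), ← integral_exp_mul_eq_cosCoeff hpi hpe]
  -- the substitution `u = T θ / a` turns the phase `u (b - b')` into `2 π n θ`
  have hsub := Measure.integral_comp_mul_left (fun u : ℝ => (f u : ℂ) *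
    ((starRingEnd ℂ) (fourierHat (dilatedFilter ψ a b) u) * fourierHat (dilatedFilter ψ a b') u))
    (T / a)
  rw [eq_comm, abs_of_pos (inv_pos.2 hTa), inv_smul_eq_iff₀ hTa.ne'] at hsub
  rw [hsub, ← integral_smul]
  refine integral_congr_ae (ae_of_all _ fun θ => ?_)
  simp only [fourierHat_dilatedFilter ha, map_mul, Complex.conj_ofReal, Complex.real_smul,
    ← Complex.exp_conj, map_neg, Complex.conj_I, hp, scaledSymbol]
  have hs : (√a : ℂ) * √a = a := by
    rw [← Complex.ofReal_mul, Real.mul_self_sqrt ha.le]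
  have ha0 : (a : ℂ) ≠ 0 := by exact_mod_cast ha.ne'
  have hγ0 : (γ : ℂ) ≠ 0 := by exact_mod_cast hγ.ne'
  have e1 : a * (T / a * θ) = T * θ := by field_simp
  have e2 : T / a * θ = T * θ / a := by ring
  have e3 : (starRingEnd ℂ) (fourierHat ψ (T * θ)) * fourierHat ψ (T * θ) =
      ((‖fourierHat ψ (T * θ)‖ ^ 2 : ℝ) : ℂ) := by
    rw [Complex.conj_mul']; push_cast; ring
  have e4 : Complex.exp (-(-Complex.I * ((T * θ / a : ℝ) : ℂ) * b)) *
      Complex.exp (-(Complex.I * ((T * θ / a : ℝ) : ℂ) * b')) =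
      Complex.exp (-(2 * Real.pi * Complex.I * ((-n : ℤ) : ℂ) * θ)) := by
    rw [← Complex.exp_add]
    congr 1
    have hb' : (b : ℂ) - b' = γ * n := by exact_mod_cast hb
    have : -(-Complex.I * ((T * θ / a : ℝ) : ℂ) * b) + -(Complex.I * ((T * θ / a : ℝ) : ℂ) * b') =
        Complex.I * ((T * θ / a : ℝ) : ℂ) * ((b : ℂ) - b') := by ring
    rw [this, hb', hT]
    push_cast
    field_simp
  rw [e1, e2]
  calc _ = ((T / a : ℝ) : ℂ) * ((f (T * θ / a) : ℂ) * (((√a : ℂ) * √a) *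
        (Complex.exp (-(-Complex.I * ((T * θ / a : ℝ) : ℂ) * b)) *
          Complex.exp (-(Complex.I * ((T * θ / a : ℝ) : ℂ) * b'))) *
        ((starRingEnd ℂ) (fourierHat ψ (T * θ)) * fourierHat ψ (T * θ)))) := by ring
    _ = _ := by
      rw [hs, e3, e4]
      push_cast
      field_simp

/-- Filter transforms at two scales whose ratio is at least `A / B` are uncorrelated: their
spectral supports meet in at most two points. -/
lemma integral_filter_mul_filter_diff [IsProbabilityMeasure P]
    (hX : IsStationaryGaussian P X) (hf : HasSpectralDensity P X f)
    (hψ : Integrable ψ) {A B : ℝ} (hB : 0 < B) (hA : 0 < A)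
    (hsupp : ∀ x, fourierHat ψ x ≠ 0 → B ≤ |x| ∧ |x| ≤ A) (ha : 0 < a) {a' b' : ℝ}
    (ha' : 0 < a') (hr : A / B ≤ a' / a) :
    ∫ ω, processIntegral X (dilatedFilter ψ a b) ω *
      processIntegral X (dilatedFilter ψ a' b') ω ∂P = 0 := by
  refine Complex.ofReal_injective ?_
  rw [integral_processIntegral_mul_eq_spectral hX hf (integrable_dilatedFilter hψ ha)
    (integrable_dilatedFilter hψ ha'), Complex.ofReal_zero]
  refine integral_eq_zero_of_ae ?_
  have hae := (toFinite ({A / a', -(A / a')} : Set ℝ)).countable.ae_notMem volume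
  filter_upwards [hae] with u hu
  by_cases h1 : fourierHat ψ (a * u) = 0
  · simp [fourierHat_dilatedFilter ha, h1]
  by_cases h2 : fourierHat ψ (a' * u) = 0
  · simp [fourierHat_dilatedFilter ha', h2]
  -- both transforms are non-zero only if `B / a ≤ |u| ≤ A / a'`, where `A / a' ≤ B / a`
  exfalso
  have k1 := (hsupp _ h1).1
  have k2 := (hsupp _ h2).2
  rw [abs_mul, abs_of_pos ha] at k1
  rw [abs_mul, abs_of_pos ha'] at k2
  rw [div_le_div_iff₀ hB ha] at hr
  have k3 : A ≤ a' * |u| := by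
    have : A * B ≤ A * (a * |u|) := by gcongr
    have : A * (a * |u|) ≤ a' * B * |u| := by
      rw [← mul_assoc]; gcongr
    nlinarith
  have k4 : |u| = A / a' := by
    rw [eq_div_iff ha'.ne']
    linarith
  refine hu ?_
  rcases abs_choice u with h | h
  · left; rw [← k4, h]
  · right; rw [mem_singleton_iff, ← k4, h, neg_neg]

end FilterCovariance

/-! ### Expansion of the mean -/

section Mean

variable {f Φ : ℝ → ℝ} {A : ℝ}

/-- The diagonal entries of the covariance matrix of a level, which are the common mean square of
its filter transforms. -/
lemma cosCoeff_scaledSymbol_zero {a T : ℝ} (hT : 0 < T) :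
    cosCoeff (scaledSymbol f Φ a T) 0 = ∫ η, f (η / a) * Φ η := by
  have h := Measure.integral_comp_mul_left (fun η => f (η / a) * Φ η) T
  rw [eq_comm, abs_of_pos (inv_pos.2 hT), inv_smul_eq_iff₀ hT.ne', smul_eq_mul,
    ← integral_const_mul] at h
  rw [h, cosCoeff]
  refine integral_congr_ae (ae_of_all _ fun θ => ?_)
  simp [scaledSymbol]

/-- A fourth-order expansion of `f` at the origin gives an expansion of `∫ f(η/a) Φ(η) dη` in
powers of `a⁻²`. -/
lemma exists_abs_integral_div_sub_le (hf : Integrable f) (hΦ : Continuous Φ) (hΦ0 : ∀ x, 0 ≤ Φ x)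
    (hΦs : ∀ x, A < |x| → Φ x = 0) {f₀ κ C : ℝ} (hC : 0 ≤ C)
    (hexp : ∀ u : ℝ, |u| ≤ 1 / 2 → |f u - (f₀ + κ * u ^ 2)| ≤ C * u ^ 4) :
    ∃ D, 0 ≤ D ∧ ∀ a : ℝ, 0 < a → 2 * A ≤ a →
      |(∫ η, f (η / a) * Φ η) - (f₀ * (∫ η, Φ η) + (a ^ 2)⁻¹ * (κ * ∫ η, η ^ 2 * Φ η))| ≤
        D * (a ^ 4)⁻¹ := by
  have hcs : HasCompactSupport Φ := HasCompactSupport.intro (isCompact_Icc (a := -A) (b := A))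
    fun x hx => hΦs x (not_le.1 fun h => hx (abs_le.1 h))
  have hint : ∀ n : ℕ, Integrable fun η => η ^ n * Φ η := fun n =>
    ((continuous_pow n).mul hΦ).integrable_of_hasCompactSupport hcs.mul_left
  have hi0 : Integrable Φ := hΦ.integrable_of_hasCompactSupport hcs
  obtain ⟨B, hB⟩ := hcs.exists_bound_of_continuous hΦ
  refine ⟨C * ∫ η, η ^ 4 * Φ η, ?_, fun a ha haA => ?_⟩
  · refine mul_nonneg hC (integral_nonneg fun η => mul_nonneg (by positivity) (hΦ0 η))
  have hfi : Integrable fun η => f (η / a) * Φ η :=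
    (hf.comp_div ha.ne').mul_bdd (c := B) hΦ.aestronglyMeasurable (ae_of_all _ hB)
  have hmain : Integrable fun η => f₀ * Φ η + (a ^ 2)⁻¹ * (κ * (η ^ 2 * Φ η)) :=
    (hi0.const_mul _).add (((hint 2).const_mul _).const_mul _)
  have e1 : f₀ * (∫ η, Φ η) + (a ^ 2)⁻¹ * (κ * ∫ η, η ^ 2 * Φ η) =
      ∫ η, (f₀ * Φ η + (a ^ 2)⁻¹ * (κ * (η ^ 2 * Φ η))) := by
    rw [integral_add (hi0.const_mul _) (((hint 2).const_mul _).const_mul _), integral_const_mul,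
      integral_const_mul, integral_const_mul]
  have e2 : C * (∫ η, η ^ 4 * Φ η) * (a ^ 4)⁻¹ = ∫ η, C * (a ^ 4)⁻¹ * (η ^ 4 * Φ η) := by
    rw [integral_const_mul]; ring
  rw [e1, e2, ← integral_sub hfi hmain]
  refine (norm_integral_le_integral_norm _).trans (integral_mono (hfi.sub hmain).norm
    ((hint 4).const_mul _) fun η => ?_)
  simp only [Real.norm_eq_abs, Pi.sub_apply]
  rcases lt_or_ge A |η| with hη | hη
  · simp [hΦs η hη]
  have h1 : |η / a| ≤ 1 / 2 := by
    rw [abs_div, abs_of_pos ha, div_le_iff₀ ha]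
    linarith
  have h2 : f (η / a) * Φ η - (f₀ * Φ η + (a ^ 2)⁻¹ * (κ * (η ^ 2 * Φ η))) =
      (f (η / a) - (f₀ + κ * (η / a) ^ 2)) * Φ η := by
    rw [div_pow]; ring
  rw [h2, abs_mul, abs_of_nonneg (hΦ0 η)]
  calc |f (η / a) - (f₀ + κ * (η / a) ^ 2)| * Φ η ≤ (C * (η / a) ^ 4) * Φ η :=
        mul_le_mul_of_nonneg_right (hexp _ h1) (hΦ0 η)
    _ = _ := by rw [div_pow]; ring

/-- If `e_j = e₀ + K a_j⁻² + O(a_j⁻⁴)`, the divided differences of `e` with respect to `a⁻²`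
approximate `K` with an error that is negligible at the scale `√m_j`. -/
lemma tendsto_sqrt_mul_divided_difference {a e : ℕ → ℝ} {m : ℕ → ℕ} {e₀ K D ρ : ℝ}
    (ha_pos : ∀ j, 0 < a j) (ha_mono : StrictMono a) (hD : 0 ≤ D)
    (he : ∀ᶠ j in atTop, |e j - (e₀ + (a j ^ 2)⁻¹ * K)| ≤ D * (a j ^ 4)⁻¹)
    (hρ : 1 < ρ) (hr : ∀ᶠ j in atTop, ρ ≤ a (j + 1) / a j)
    (hm : Tendsto (fun j => (m j : ℝ) * (a j ^ 4)⁻¹) atTop (𝓝 0)) :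
    Tendsto (fun j => √(m j : ℝ) * ((e (j + 1) - e (j + 2)) /
      ((a (j + 1) ^ 2)⁻¹ - (a (j + 2) ^ 2)⁻¹) - K)) atTop (𝓝 0) := by
  -- the increments of `a⁻²` are at least `σ` times `a⁻²` since the scales grow geometrically
  set σ := 1 - (ρ ^ 2)⁻¹ with hσ
  have hσ0 : 0 < σ := by
    have : (ρ ^ 2)⁻¹ < 1 := inv_lt_one_of_one_lt₀ (by nlinarith)
    linarith
  have hlim : Tendsto (fun j => 2 * D / σ * √((m j : ℝ) * (a j ^ 4)⁻¹)) atTop (𝓝 0) := by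
    have := ((Real.continuous_sqrt.tendsto 0).comp hm).const_mul (2 * D / σ)
    simpa using this
  refine squeeze_zero_norm' ?_ hlim
  filter_upwards [(tendsto_add_atTop_nat 1).eventually he, (tendsto_add_atTop_nat 2).eventually he,
    (tendsto_add_atTop_nat 1).eventually hr] with j h1 h2 h3
  have p0 := ha_pos j
  have p1 := ha_pos (j + 1)
  have p2 := ha_pos (j + 2)
  have h01 := ha_mono (Nat.lt_succ_self j)
  have h12 : a (j + 1) < a (j + 2) := ha_mono (Nat.lt_succ_self _)
  set x := (a (j + 1) ^ 2)⁻¹ with hx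
  set y := (a (j + 2) ^ 2)⁻¹ with hy
  have hx0 : 0 < x := by positivity
  have hy0 : 0 < y := by positivity
  have hyx : y ≤ (ρ ^ 2)⁻¹ * x := by
    rw [hx, hy, ← mul_inv, ← mul_pow]
    rw [le_div_iff₀ p1] at h3
    gcongr
  have hxy : σ * x ≤ x - y := by rw [hσ]; linarith
  have hxy0 : 0 < x - y := lt_of_lt_of_le (by positivity) hxy
  have ex : (a (j + 1) ^ 4)⁻¹ = x ^ 2 := by rw [hx, inv_pow]; ring
  have ey : (a (j + 2) ^ 4)⁻¹ = y ^ 2 := by rw [hy, inv_pow]; ring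
  rw [ex] at h1
  rw [ey] at h2
  have hyx' : y ≤ x := by linarith
  have hdiff : |(e (j + 1) - e (j + 2)) / (x - y) - K| ≤ 2 * D / σ * x := by
    have e1 : (e (j + 1) - e (j + 2)) / (x - y) - K =
        ((e (j + 1) - (e₀ + x * K)) - (e (j + 2) - (e₀ + y * K))) / (x - y) := by
      field_simp
      ring
    rw [e1, abs_div, abs_of_pos hxy0, div_le_iff₀ hxy0]
    calc _ ≤ D * x ^ 2 + D * y ^ 2 := (abs_sub _ _).trans (add_le_add h1 h2)
      _ ≤ D * x ^ 2 + D * x ^ 2 := by gcongr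
      _ = 2 * D / σ * x * (σ * x) := by field_simp; ring
      _ ≤ 2 * D / σ * x * (x - y) := by gcongr
  have hsq : √(m j : ℝ) * x ≤ √((m j : ℝ) * (a j ^ 4)⁻¹) := by
    rw [Real.sqrt_mul (Nat.cast_nonneg _)]
    gcongr
    have : (a j ^ 4)⁻¹ = ((a j ^ 2)⁻¹) ^ 2 := by rw [inv_pow]; ring
    rw [this, Real.sqrt_sq (by positivity), hx]
    gcongr
  rw [norm_mul, Real.norm_of_nonneg (Real.sqrt_nonneg _), Real.norm_eq_abs]
  calc √(m j : ℝ) * |(e (j + 1) - e (j + 2)) / (x - y) - K|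
      ≤ √(m j : ℝ) * (2 * D / σ * x) := by gcongr
    _ = 2 * D / σ * (√(m j : ℝ) * x) := by ring
    _ ≤ _ := by gcongr

end Mean

/-! ### Sample sizes and the limit variance -/

section Normalisation

lemma increment_pos {a : ℕ → ℝ} (ha_pos : ∀ j, 0 < a j) (ha_mono : StrictMono a) (j : ℕ) :
    0 < (a (j + 1) ^ 2)⁻¹ - (a (j + 2) ^ 2)⁻¹ := by
  have h1 := ha_pos (j + 1)
  have h12 : a (j + 1) < a (j + 2) := ha_mono (Nat.lt_succ_self _)
  rw [sub_pos]
  gcongr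

variable {a : ℕ → ℝ} {m : ℕ → ℕ}

lemma tendsto_sampleSize_ratio (ha_pos : ∀ j, 0 < a j) (ha_mono : StrictMono a)
    (ha_top : Tendsto a atTop atTop) (hm_pos : ∀ j, 0 < m j) :
    Tendsto (fun j => (m j : ℝ) / ((a (j + 1) ^ 2)⁻¹ - (a (j + 2) ^ 2)⁻¹) ^ 2) atTop atTop := by
  have hΔ : Tendsto (fun j => ((a (j + 1) ^ 2)⁻¹ - (a (j + 2) ^ 2)⁻¹) ^ 2) atTop (𝓝[>] 0) := by
    refine tendsto_nhdsWithin_iff.2 ⟨?_, Eventually.of_forall fun j =>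
      pow_pos (increment_pos ha_pos ha_mono j) 2⟩
    have h : Tendsto (fun j => (a j ^ 2)⁻¹) atTop (𝓝 0) :=
      ((tendsto_pow_atTop two_ne_zero).comp ha_top).inv_tendsto_atTop
    have := ((h.comp (tendsto_add_atTop_nat 1)).sub (h.comp (tendsto_add_atTop_nat 2))).pow 2
    simpa using this
  refine tendsto_atTop_mono (fun j => ?_) hΔ.inv_tendsto_nhdsGT_zero
  have : (1 : ℝ) ≤ m j := by exact_mod_cast hm_pos j
  rw [Pi.inv_apply, inv_eq_one_div]
  gcongr

lemma tendsto_sampleSize (ha_pos : ∀ j, 0 < a j) (ha_mono : StrictMono a)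
    (ha_top : Tendsto a atTop atTop) (hm_pos : ∀ j, 0 < m j) :
    Tendsto (sampleSize a m) atTop atTop :=
  tendsto_nat_floor_atTop.comp (tendsto_sampleSize_ratio ha_pos ha_mono ha_top hm_pos)

/-- The factor `√m_j / (Δ_j M_j)` in front of the centred sums of squares, where
`Δ_j = a_{j+1}⁻² - a_{j+2}⁻²`. -/
noncomputable def normalisingFactor (a : ℕ → ℝ) (m : ℕ → ℕ) (j : ℕ) : ℝ :=
  √(m j : ℝ) / (((a (j + 1) ^ 2)⁻¹ - (a (j + 2) ^ 2)⁻¹) * sampleSize a m j)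

lemma tendsto_normalisingFactor_sq_mul (ha_pos : ∀ j, 0 < a j) (ha_mono : StrictMono a)
    (ha_top : Tendsto a atTop atTop) (hm_pos : ∀ j, 0 < m j) :
    Tendsto (fun j => normalisingFactor a m j ^ 2 * sampleSize a m j) atTop (𝓝 1) := by
  have h := (tendsto_nat_floor_div_atTop (R := ℝ)).comp
    (tendsto_sampleSize_ratio ha_pos ha_mono ha_top hm_pos)
  have h2 := h.inv₀ one_ne_zero
  rw [inv_one] at h2
  refine h2.congr' ?_
  filter_upwards [(tendsto_sampleSize ha_pos ha_mono ha_top hm_pos).eventually_gt_atTop 0] with j hj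
  have hM : (0 : ℝ) < sampleSize a m j := by exact_mod_cast hj
  have hΔ := increment_pos ha_pos ha_mono j
  have hM' : ((⌊(m j : ℝ) / ((a (j + 1) ^ 2)⁻¹ - (a (j + 2) ^ 2)⁻¹) ^ 2⌋₊ : ℕ) : ℝ) =
    sampleSize a m j := rfl
  simp only [Function.comp_apply, normalisingFactor]
  rw [hM', div_pow, Real.sq_sqrt (Nat.cast_nonneg _)]
  set Δ := (a (j + 1) ^ 2)⁻¹ - (a (j + 2) ^ 2)⁻¹
  field_simp

lemma normalisingFactor_nonneg (ha_pos : ∀ j, 0 < a j) (ha_mono : StrictMono a) (j : ℕ) :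
    0 ≤ normalisingFactor a m j := by
  have := increment_pos ha_pos ha_mono j
  unfold normalisingFactor
  positivity

lemma tendsto_normalisingFactor (ha_pos : ∀ j, 0 < a j) (ha_mono : StrictMono a)
    (ha_top : Tendsto a atTop atTop) (hm_pos : ∀ j, 0 < m j) :
    Tendsto (normalisingFactor a m) atTop (𝓝 0) := by
  have h1 := tendsto_normalisingFactor_sq_mul ha_pos ha_mono ha_top hm_pos
  have hM := tendsto_sampleSize ha_pos ha_mono ha_top hm_pos
  have h2 := h1.mul (tendsto_inv_atTop_zero.comp (tendsto_natCast_atTop_atTop.comp hM))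
  rw [mul_zero] at h2
  have h3 : Tendsto (fun j => normalisingFactor a m j ^ 2) atTop (𝓝 0) := by
    refine h2.congr' ?_
    filter_upwards [hM.eventually_gt_atTop 0] with j hj
    have hM : (sampleSize a m j : ℝ) ≠ 0 := by exact_mod_cast hj.ne'
    simp only [Function.comp_apply]
    field_simp
  have h4 := (Real.continuous_sqrt.tendsto 0).comp h3
  rw [Real.sqrt_zero] at h4
  refine h4.congr fun j => ?_
  exact Real.sqrt_sq (normalisingFactor_nonneg ha_pos ha_mono j)

/-- The limit variance in terms of a `1`-periodic symbol: the substitution `η = 2πcx` maps one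
period to `[-cπ, cπ]`, and periodicity shifts it to `[0, 1]`. -/
lemma limitVariance_eq (ψ : ℝ → ℝ) {s₀ α c : ℝ} (hs : 0 < s₀) (hc : 0 < c) :
    limitVariance ψ s₀ α c = 2 * ∫ x in (0 : ℝ)..1, (∑' k : ℤ, 2 * Real.pi * c *
      (s₀ ^ (-4 * α) * ‖fourierHat ψ (2 * Real.pi * c * (x + k))‖ ^ 2)) ^ 2 := by
  set T := 2 * Real.pi * c with hT
  have hTpos : 0 < T := by positivity
  set G : ℝ → ℝ := fun η => (∑' k : ℤ, ‖fourierHat ψ (η + T * k)‖ ^ 2) ^ 2 with hG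
  have hper : Function.Periodic (fun x => G (T * x)) 1 := by
    intro x
    simp only [hG]
    congr 1
    rw [← (Equiv.addRight (1 : ℤ)).tsum_eq fun k : ℤ => ‖fourierHat ψ (T * x + T * k)‖ ^ 2]
    refine tsum_congr fun k => ?_
    simp only [Equiv.coe_addRight]
    congr 3
    push_cast
    ring
  have h1 : ∫ η in (-(c * Real.pi))..(c * Real.pi),
      |∑' n : ℤ, ‖fourierHat ψ (η + 2 * n * c * Real.pi)‖ ^ 2| ^ 2 =
      ∫ η in (-(c * Real.pi))..(c * Real.pi), G η := by
    refine intervalIntegral.integral_congr fun η _ => ?_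
    simp only [hG, sq_abs]
    congr 1
    refine tsum_congr fun k => ?_
    congr 3
    rw [hT]; ring
  have h2 : ∫ η in (-(c * Real.pi))..(c * Real.pi), G η = T * ∫ x in (0 : ℝ)..1, G (T * x) := by
    have hp := hper.intervalIntegral_add_eq (-(1 / 2)) 0
    rw [zero_add] at hp
    rw [← hp, intervalIntegral.integral_comp_mul_left G hTpos.ne', smul_eq_mul, ← mul_assoc,
      mul_inv_cancel₀ hTpos.ne', one_mul]
    congr 1 <;> rw [hT] <;> ring
  have h3 : ∀ x : ℝ, (∑' k : ℤ, T * (s₀ ^ (-4 * α) * ‖fourierHat ψ (T * (x + k))‖ ^ 2)) ^ 2 =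
      T ^ 2 * (s₀ ^ (-4 * α)) ^ 2 * G (T * x) := by
    intro x
    rw [tsum_mul_left, tsum_mul_left, mul_pow, mul_pow]
    simp only [hG, mul_add]
    ring
  have h4 : (s₀ ^ (-4 * α)) ^ 2 = s₀ ^ (-8 * α) := by
    rw [← Real.rpow_natCast, ← Real.rpow_mul hs.le]
    congr 1
    push_cast; ring
  simp_rw [h3]
  rw [limitVariance, h1, h2, intervalIntegral.integral_const_mul, h4, hT]
  ring

end Normalisation

/-! ### The limit theorem -/

section Main

lemma filterTransform_eq {Ω : Type*} (ψ : ℝ → ℝ) (X : ℝ → Ω → ℝ) (a : ℕ → ℝ) (b : ℕ → ℤ → ℝ)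
    (j : ℕ) (k : ℤ) :
    filterTransform ψ X a b j k = processIntegral X (dilatedFilter ψ (a j) (b j k)) := by
  funext ω
  simp only [filterTransform, processIntegral, dilatedFilter]
  rw [← integral_const_mul]
  simp only [mul_assoc]

variable {Ω : Type*} [MeasurableSpace Ω] {P : Measure Ω}

/-- Filter transforms, over any finite set of scales and locations, are jointly Gaussian. -/
lemma hasGaussianLaw_filterTransform [IsProbabilityMeasure P] {X : ℝ → Ω → ℝ} {f ψ : ℝ → ℝ}
    (hX : IsStationaryGaussian P X) (hf : HasSpectralDensity P X f) (hψ : Integrable ψ)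
    {a : ℕ → ℝ} (ha : ∀ j, 0 < a j) (b : ℕ → ℤ → ℝ) {ι : Type*} [Fintype ι] (s : ι → ℕ × ℤ) :
    HasGaussianLaw (fun ω i => filterTransform ψ X a b (s i).1 (s i).2 ω) P ∧
      ∀ i, ∫ ω, filterTransform ψ X a b (s i).1 (s i).2 ω ∂P = 0 := by
  have hV := hX.integral_sq_le hf
  have hφ : ∀ i, Integrable (dilatedFilter ψ (a (s i).1) (b (s i).1 (s i).2)) := fun i =>
    integrable_dilatedFilter hψ (ha _)
  have hmem := fun i => memLp_processIntegral hX.measurable_uncurry hX.memLp_two hV (hφ i)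
  have hK := fun i =>
    processIntegral_mem_processSpace hX.measurable_uncurry hX.memLp_two hV (hφ i) (hmem i)
  simp only [filterTransform_eq]
  exact ⟨hasGaussianLaw_of_mem_processSpace hX.memLp_two hX.gaussian hX.centred hmem hK,
    fun i => integral_eq_zero_of_mem_processSpace hX.memLp_two hX.gaussian hX.centred
      (hmem i) (hK i)⟩

lemma sum_Icc_eq_sum_fin (F : ℤ → ℝ) (n : ℕ) :
    ∑ k ∈ Finset.Icc 1 n, F (k : ℤ) = ∑ i : Fin n, F ((i : ℤ) + 1) := by
  rw [← Finset.Ico_succ_right_eq_Icc, Finset.sum_Ico_eq_sum_range]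
  simp only [Nat.succ_eq_succ, Nat.succ_eq_add_one, Nat.add_sub_cancel]
  rw [Finset.sum_range]
  refine Finset.sum_congr rfl fun i _ => ?_
  congr 1
  push_cast
  ring

lemma charFun_map_add_const_comp {Y : Ω → ℝ} (hY : AEMeasurable Y P) (d t : ℝ) :
    charFun (P.map fun ω => Y ω + d) t =
      charFun (P.map Y) t * Complex.exp (((d * t : ℝ) : ℂ) * Complex.I) := by
  have h : (fun ω => Y ω + d) = (fun x => x + d) ∘ Y := rfl
  rw [h, ← AEMeasurable.map_map_of_aemeasurable (by fun_prop) hY, charFun_map_add_const]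
  simp [mul_comm]

/-- Convergence to a centred Gaussian law from convergence of characteristic functions, with a
deterministic correction that tends to zero. -/
lemma tendstoInDistribution_of_tendsto_charFun [IsProbabilityMeasure P] {W U : ℕ → Ω → ℝ}
    {d : ℕ → ℝ} (hW : ∀ j, AEMeasurable (W j) P) (hU : ∀ᶠ j in atTop, AEMeasurable (U j) P)
    (hWU : ∀ᶠ j in atTop, ∀ ω, W j ω = U j ω + d j) (hd : Tendsto d atTop (𝓝 0)) {τ : ℝ}
    (hτ : 0 ≤ τ)
    (hchar : ∀ t : ℝ, Tendsto (fun j => charFun (P.map (U j)) t) atTop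
      (𝓝 (Complex.exp (-((τ * t ^ 2 : ℝ) : ℂ) / 2)))) :
    TendstoInDistribution W atTop (id : ℝ → ℝ) (fun _ => P) (gaussianReal 0 τ.toNNReal) where
  forall_aemeasurable := hW
  tendsto := by
    refine ProbabilityMeasure.tendsto_iff_tendsto_charFun.2 fun t => ?_
    simp only [ProbabilityMeasure.coe_mk, Measure.map_id, charFun_gaussianReal]
    have hc : Continuous fun x : ℝ => Complex.exp (((x * t : ℝ) : ℂ) * Complex.I) := by fun_prop
    have h1 := (hchar t).mul ((hc.tendsto 0).comp hd)
    simp only [zero_mul, Complex.ofReal_zero, Complex.exp_zero, mul_one] at h1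
    have h2 : Complex.exp (t * ((0 : ℝ) : ℂ) * Complex.I - ((τ.toNNReal : ℝ) : ℂ) * t ^ 2 / 2) =
        Complex.exp (-((τ * t ^ 2 : ℝ) : ℂ) / 2) := by
      rw [Real.coe_toNNReal _ hτ]
      congr 1
      push_cast
      ring
    rw [h2]
    refine h1.congr' ?_
    filter_upwards [hU, hWU] with j hj hWj
    rw [show W j = fun ω => U j ω + d j from funext hWj, charFun_map_add_const_comp hj]
    rfl

end Main

theorem mainTheorem3 {Ω : Type*} [MeasurableSpace Ω] (P : Measure Ω) [IsProbabilityMeasure P]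
    -- the process and its semiparametric spectral density
    (X : ℝ → Ω → ℝ) (s₀ α : ℝ) (h : ℝ → ℝ)
    (hX : IsStationaryGaussian P X)
    (hmodel : IsCyclicModel s₀ α h)
    (hf : HasSpectralDensity P X (cyclicDensity s₀ α h))
    -- the filter
    (ψ : ℝ → ℝ) (hψ : Integrable ψ)
    (A B : ℝ) (hB : 0 < B) (hBA : B < A)
    (hbv : BoundedVariationOn (fourierHat ψ) (Icc (-A) A))
    (hsupp : tsupport (fourierHat ψ) ⊆ {ξ : ℝ | B ≤ |ξ| ∧ |ξ| ≤ A})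
    -- the scales `a`, the sample sizes `m` and the locations `b`
    (a : ℕ → ℝ) (ha_pos : ∀ j, 0 < a j) (ha_mono : StrictMono a) (ha_top : Tendsto a atTop atTop)
    (m : ℕ → ℕ) (hm_pos : ∀ j, 0 < m j) (hm_mono : Monotone m) (hm_top : Tendsto m atTop atTop)
    (b : ℕ → ℤ → ℝ) (γ : ℕ → ℝ) (hγ : ∀ j, 0 < γ j)
    (hb : ∀ (j : ℕ) (k l : ℤ), b j k - b j l = γ j * ((k : ℝ) - (l : ℝ)))
    (c : ℝ) (hc : 0 < c)
    (hγc : Tendsto (fun j => a j / γ j) atTop (𝓝 c))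
    (hγc_rate : Tendsto (fun j => (m j : ℝ) ^ 2 * a j ^ 8 * (γ j / a j - 1 / c)) atTop (𝓝 0))
    (ha_ratio : ∃ j₀ : ℕ, ∀ j ≥ j₀, A / B ≤ a (j + 1) / a j)
    (hm_rate : Tendsto (fun j => (m j : ℝ) * (a j ^ 4)⁻¹) atTop (𝓝 0)) :
    TendstoInDistribution
      (fun (j : ℕ) (ω : Ω) => √(m j : ℝ) *
        (normalisedIncrement ψ X a b m j ω -
          2 * α * s₀ ^ (-4 * α - 2) * ∫ η : ℝ, η ^ 2 * ‖fourierHat ψ η‖ ^ 2))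
      atTop (id : ℝ → ℝ) (fun _ => P)
      (gaussianReal 0 (2 * limitVariance ψ s₀ α c).toNNReal) := by
  have hs₀ : 0 < s₀ := by linarith [hmodel.one_lt]
  have hA : 0 < A := hB.trans hBA
  set f := cyclicDensity s₀ α h with hfdef
  set Φ : ℝ → ℝ := fun x => ‖fourierHat ψ x‖ ^ 2 with hΦdef
  have hfe : ∀ x, f (-x) = f x := cyclicDensity_neg hmodel.even
  have hfc : ∀ u, |u| < s₀ → ContinuousAt f u := fun u hu =>
    continuousAt_cyclicDensity hmodel.contDiff.continuous hu
  have hf0 : f 0 = s₀ ^ (-4 * α) := cyclicDensity_zero hs₀ hmodel.at_zero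
  have hsupp' : ∀ x, fourierHat ψ x ≠ 0 → B ≤ |x| ∧ |x| ≤ A := fun x hx =>
    hsupp (subset_tsupport _ hx)
  have hΦc : Continuous Φ := (continuous_fourierHat hψ).norm.pow 2
  have hΦ0 : ∀ x, 0 ≤ Φ x := fun x => by positivity
  have hΦe : ∀ x, Φ (-x) = Φ x := fun x => by
    simp only [hΦdef, fourierHat_neg, RCLike.norm_conj]
  have hΦs : ∀ x, A < |x| → Φ x = 0 := fun x hx => by
    have : fourierHat ψ x = 0 := by
      by_contra hne
      exact absurd (hsupp' x hne).2 (not_le.2 hx)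
    simp [hΦdef, this]
  -- the symbols of the levels and their limit
  set T : ℕ → ℝ := fun j => 2 * Real.pi * a j / γ j with hTdef
  set T₀ : ℝ := 2 * Real.pi * c with hT₀def
  have hT₀ : 0 < T₀ := by positivity
  have hTpos : ∀ j, 0 < T j := fun j => by
    have := ha_pos j
    have := hγ j
    positivity
  have hT : Tendsto T atTop (𝓝 T₀) := by
    refine (hγc.const_mul (2 * Real.pi)).congr fun j => ?_
    simp only [hTdef]
    ring
  set p : ℕ → ℝ → ℝ := fun j => scaledSymbol f Φ (a j) (T j) with hpdef
  set q : ℝ → ℝ := fun θ => T₀ * (f 0 * Φ (T₀ * θ)) with hqdef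
  -- the factor `2` leaves room for `T j` to differ from its limit
  obtain ⟨N, hN⟩ := exists_nat_ge (2 * A / T₀)
  have hp : ∀ᶠ j in atTop, Continuous (p j) ∧ (∀ x, p j (-x) = p j x) ∧
      ∀ x, (N : ℝ) < |x| → p j x = 0 := by
    filter_upwards [ha_top.eventually_gt_atTop (A / s₀),
      hT.eventually_const_lt (by linarith : T₀ / 2 < T₀)] with j h1 h2
    refine ⟨continuous_scaledSymbol _ (ha_pos j) ?_ hfc hΦc hΦs,
      scaledSymbol_neg hfe hΦe _ _, fun x hx =>
      scaledSymbol_eq_zero_of_support hΦs (hTpos j) ?_ hx⟩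
    · rwa [div_lt_iff₀ hs₀] at h1
    · refine le_trans ?_ hN
      rw [div_le_div_iff₀ (hTpos j) hT₀]
      nlinarith
  have hqc : Continuous q := by
    simp only [hqdef]
    fun_prop
  have hqe : ∀ x, q (-x) = q x := fun x => by simp only [hqdef, mul_neg, hΦe]
  have hqs : ∀ x, (N : ℝ) < |x| → q x = 0 := fun x hx => by
    have : A < |T₀ * x| := by
      rw [abs_mul, abs_of_pos hT₀]
      rw [div_le_iff₀ hT₀] at hN
      nlinarith
    simp [hqdef, hΦs _ this]
  have hpq : ∀ ε > 0, ∀ᶠ j in atTop, ∀ x, |p j x - q x| ≤ ε := fun ε hε =>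
    eventually_abs_scaledSymbol_sub_le (hfc 0 (by simpa using hs₀)) hΦc hΦs hT₀ ha_top hT hε
  obtain ⟨Q, hQ⟩ : ∃ Q, ∀ x, q x ≤ Q := by
    have hcs : HasCompactSupport q := HasCompactSupport.intro
      (isCompact_Icc (a := -(N : ℝ)) (b := N)) fun x hx => hqs x (not_le.1 fun h => hx (abs_le.1 h))
    obtain ⟨Q, hQ⟩ := hcs.exists_bound_of_continuous hqc
    exact ⟨Q, fun x => (le_abs_self _).trans (hQ x)⟩
  set M := sampleSize a m with hMdef
  have hM : Tendsto M atTop atTop := tendsto_sampleSize ha_pos ha_mono ha_top hm_pos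
  set s := normalisingFactor a m with hsdef
  have hs_nonneg : ∀ j, 0 ≤ s j := normalisingFactor_nonneg ha_pos ha_mono
  -- the two families of filter transforms, at the levels `j + 1` and `j + 2`
  set Z : ∀ j, Fin 2 → Fin (M j) → Ω → ℝ := fun j κ i =>
    filterTransform ψ X a b (j + 1 + κ) ((i : ℤ) + 1) with hZ
  set R : ∀ j, Fin 2 → Matrix (Fin (M j)) (Fin (M j)) ℝ := fun j κ k l =>
    cosCoeff (p (j + 1 + κ)) ((k : ℤ) - (l : ℤ)) with hR
  have hZG : ∀ᶠ j in atTop, HasGaussianLaw (fun ω (x : Fin 2 × Fin (M j)) => Z j x.1 x.2 ω) P ∧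
      (∀ κ k, ∫ ω, Z j κ k ω ∂P = 0) ∧
      (∀ κ k l, ∫ ω, Z j κ k ω * Z j κ l ω ∂P = R j κ k l) ∧
      ∀ κ κ', κ ≠ κ' → ∀ k l, ∫ ω, Z j κ k ω * Z j κ' l ω ∂P = 0 := by
    obtain ⟨j₀, hj₀⟩ := ha_ratio
    filter_upwards [eventually_ge_atTop j₀] with j hj
    have hG := hasGaussianLaw_filterTransform hX hf hψ ha_pos b
      (fun x : Fin 2 × Fin (M j) => (j + 1 + (x.1 : ℕ), ((x.2 : ℕ) : ℤ) + 1))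
    have hcross : ∀ k l, ∫ ω, Z j 0 k ω * Z j 1 l ω ∂P = 0 := by
      intro k l
      simp only [hZ, filterTransform_eq]
      exact integral_filter_mul_filter_diff hX hf hψ hB hA hsupp' (ha_pos _) (ha_pos _)
        (hj₀ (j + 1) (by omega))
    refine ⟨hG.1, fun κ k => hG.2 (κ, k), ?_, ?_⟩
    · intro κ k l
      simp only [hZ, hR, filterTransform_eq]
      refine integral_filter_mul_filter_same hX hf hfe hψ (ha_pos _) (hγ _) ?_
      rw [hb]
      push_cast
      ring
    · intro κ κ' hne k l
      fin_cases κ <;> fin_cases κ'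
      · exact absurd rfl hne
      · exact hcross k l
      · have := hcross l k
        simp_rw [mul_comm (Z j 0 l _)] at this
        exact this
      · exact absurd rfl hne
  have hshift : ∀ κ : Fin 2, Tendsto (fun j : ℕ => j + 1 + (κ : ℕ)) atTop atTop := fun κ =>
    tendsto_atTop_mono (fun j => by simp only [id]; omega) tendsto_id
  -- the two levels enter the increment with opposite signs
  set w : ℕ → Fin 2 → ℝ := fun j κ => ![1, -1] κ * s j with hw
  have hw_abs : ∀ j κ, |w j κ| = s j := fun j κ => by
    simp only [hw, abs_mul, abs_of_nonneg (hs_nonneg j)]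
    fin_cases κ <;> simp
  have hw_sq : ∀ j κ, w j κ ^ 2 = s j ^ 2 := fun j κ => by rw [← sq_abs, hw_abs]
  set I := ∫ x in (0 : ℝ)..1, (∑' k : ℤ, q (x + k)) ^ 2 with hI
  have hLV : limitVariance ψ s₀ α c = 2 * I := by
    rw [limitVariance_eq ψ hs₀ hc, hI]
    simp only [hqdef, hf0, hΦdef, hT₀def]
  have hI0 : 0 ≤ I := intervalIntegral.integral_nonneg zero_le_one fun x _ => sq_nonneg _
  have hsum : Tendsto (fun j => ∑ κ, 2 * w j κ ^ 2 * ∑ k, ∑ l, R j κ k l ^ 2) atTop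
      (𝓝 (2 * limitVariance ψ s₀ α c)) := by
    have hav : ∀ κ : Fin 2, Tendsto (fun j => (M j : ℝ)⁻¹ * ∑ k, ∑ l, R j κ k l ^ 2) atTop
        (𝓝 I) := fun κ =>
      tendsto_toeplitz_average_sq_cosCoeff (p := fun j => p (j + 1 + (κ : ℕ)))
        ((hshift κ).eventually hp) hqc hqe hqs
        (fun ε hε => (hshift κ).eventually (hpq ε hε)) hM
    have h1 := (tendsto_normalisingFactor_sq_mul ha_pos ha_mono ha_top hm_pos).const_mul 2
    have h2 := h1.mul ((hav 0).add (hav 1))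
    rw [hLV, show 2 * (2 * I) = 2 * 1 * (I + I) by ring]
    refine h2.congr' ?_
    filter_upwards [hM.eventually_gt_atTop 0] with j hj
    have hMj : (M j : ℝ) ≠ 0 := by exact_mod_cast hj.ne'
    simp only [Fin.sum_univ_two, hw_sq, ← hsdef, ← hMdef]
    field_simp
  have hmax : ∀ ε > 0, ∀ᶠ j in atTop, ∀ κ, ∃ C, |w j κ| * C ≤ ε ∧
      ∀ x : Fin (M j) → ℝ, ∑ k, ∑ l, x k * x l * R j κ k l ≤ C * ∑ k, x k ^ 2 := by
    intro ε hε
    have h1 := (tendsto_normalisingFactor ha_pos ha_mono ha_top hm_pos).mul_const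
      (2 * N * (Q + 1))
    rw [zero_mul] at h1
    refine (h1.eventually_le_const hε).and (eventually_all.2 fun κ =>
      ((hshift κ).eventually hp).and ((hshift κ).eventually (hpq 1 one_pos))) |>.mono ?_
    rintro j ⟨hj1, hj2⟩ κ
    obtain ⟨⟨k1, -, k3⟩, k4⟩ := hj2 κ
    refine ⟨2 * N * (Q + 1), by rw [hw_abs]; exact hj1, fun x => toeplitz_form_le k1 k3 ?_ x⟩
    intro θ
    have := (abs_le.1 (k4 θ)).2
    linarith [hQ θ]
  have hchar := tendsto_charFun_sum_weight_mul_sum_sq w hZG hsum hmax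
  -- the expectations of the levels
  set e : ℕ → ℝ := fun j => ∫ η, f (η / a j) * Φ η with hedef
  obtain ⟨C, hC, hexp⟩ := exists_abs_cyclicDensity_sub_le hmodel
  obtain ⟨D, hD, hmean⟩ := exists_abs_integral_div_sub_le hf.integrable hΦc hΦ0 hΦs hC hexp
  have hd := tendsto_sqrt_mul_divided_difference (e := e) ha_pos ha_mono hD
    ((ha_top.eventually_ge_atTop (2 * A)).mono fun j hj => hmean (a j) (ha_pos j) hj)
    ((one_lt_div hB).2 hBA) (eventually_atTop.2 ha_ratio) hm_rate
  have hZm : ∀ j k, AEMeasurable (filterTransform ψ X a b j k) P := fun j k => by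
    rw [filterTransform_eq]
    exact (aestronglyMeasurable_processIntegral hX.measurable_uncurry
      (integrable_dilatedFilter hψ (ha_pos j))).aemeasurable
  refine tendstoInDistribution_of_tendsto_charFun (fun j => ?_) (Eventually.of_forall fun j => ?_)
    ?_ hd (by rw [hLV]; positivity) hchar
  · simp only [normalisedIncrement, meanSquareCoeff]
    fun_prop
  · simp only [hZ]
    fun_prop
  · filter_upwards [hM.eventually_gt_atTop 0] with j hj ω
    have hMj : (M j : ℝ) ≠ 0 := by exact_mod_cast hj.ne'
    have hΔ := (increment_pos ha_pos ha_mono j).ne'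
    have hdiag : ∀ κ, ∑ k, R j κ k k = M j * e (j + 1 + κ) := fun κ => by
      simp only [hR, sub_self, hpdef, cosCoeff_scaledSymbol_zero (hTpos _), Finset.sum_const,
        Finset.card_univ, Fintype.card_fin, nsmul_eq_mul, hedef]
    simp only [Fin.sum_univ_two, hdiag, hw, normalisedIncrement, meanSquareCoeff, ← hMdef]
    rw [sum_Icc_eq_sum_fin (fun k => filterTransform ψ X a b (j + 1) k ω ^ 2),
      sum_Icc_eq_sum_fin (fun k => filterTransform ψ X a b (j + 2) k ω ^ 2)]
    simp only [hZ, hsdef, normalisingFactor, ← hMdef, Fin.val_zero, Fin.val_one, add_zero,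
      Matrix.cons_val_zero, Matrix.cons_val_one]
    rw [show j + 1 + 1 = j + 2 from rfl,
      show ∫ η, η ^ 2 * ‖fourierHat ψ η‖ ^ 2 = ∫ η, η ^ 2 * Φ η from rfl]
    field_simp
    ring
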